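/- Work over a field $k$, $\otimes=\otimes_k$. Let $A$ be an associative unital algebra with multiplication $\mu$ and with a linear functional $\varepsilon_A$, and let $C$ be a coassociative counital coalgebra with a distinguished element $1_C\in C$; write $\Delta_C(c)=c_1\otimes c_2$ and put $\mu_2=\mu\circ(\mathrm{id}\otimes\mu)$. *Crossed products.* Linear maps $R:C\otimes A\to A\otimes C$, $\sigma:C\otimes C\to A\otimes C$ afford a crossed product algebra $A\otimes_{R,\sigma}C$ if $R(1_C\otimes a)=a\otimes 1_C$, $R(c\otimes 1_A)=1_A\otimes c$, $\sigma(1_C\otimes c)=\sigma(c\otimes 1_C)=1_A\otimes c$ and $$R(\mathrm{id}\otimes\mu)=(\mu\otimes\mathrm{id})(\mathrm{id}\otimes R)(R\otimes\mathrm{id}),$$ $$(\mu\otimes\mathrm{id})(\mathrm{id}\otimes\sigma)(R\otimes\mathrm{id})(\mathrm{id}\otimes\sigma)=(\mu\otimes\mathrm{id})(\mathrm{id}\otimes\sigma)(\sigma\otimes\mathrm{id}),$$ $$(\mu\otimes\mathrm{id})(\mathrm{id}\otimes\sigma)(R\otimes\mathrm{id})(\mathrm{id}\otimes R)=(\mu\otimes\mathrm{id})(\mathrm{id}\otimes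 R)(\sigma\otimes\mathrm{id});$$ this is the space $A\otimes C$ with unit $1_A\otimes 1_C$ and multiplication $(\mu_2\otimes\mathrm{id})(\mathrm{id}\otimes\mathrm{id}\otimes\sigma)(\mathrm{id}\otimes R\otimes\mathrm{id})$. *Crossed coproducts.* Linear maps $W:A\otimes C\to C\otimes A$, $\rho:A\otimes C\to A\otimes A$ afford a crossed coproduct coalgebra $A_{W,\rho}\otimes C$ if $(\mathrm{id}\otimes\varepsilon_A)W=\varepsilon_A\otimes\mathrm{id}$, $(\varepsilon_C\otimes\mathrm{id})W=\mathrm{id}\otimes\varepsilon_C$, $(\mathrm{id}\otimes\varepsilon_A)\rho=\mathrm{id}\otimes\varepsilon_C=(\varepsilon_A\otimes\mathrm{id})\rho$ and $$(\Delta_C\otimes\mathrm{id})W=(\mathrm{id}\otimes W)(W\otimes\mathrm{id})(\mathrm{id}\otimes\Delta_C),$$ $$(\rho\otimes\mathrm{id})(\mathrm{id}\otimes W)(\rho\otimes\mathrm{id})(\mathrm{id}\otimes\Delta_C)=(\mathrm{id}\otimes\rho)(\rho\otimes\mathrm{id})(\mathrm{id}\otimes\Delta_C),$$ $$(W\otimes\mathrm{id})(\mathrm{id}\otimes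 W)(\rho\otimes\mathrm{id})(\mathrm{id}\otimes\Delta_C)=(\mathrm{id}\otimes\rho)(W\otimes\mathrm{id})(\mathrm{id}\otimes\Delta_C);$$ this is the space $A\otimes C$ with counit $\varepsilon_A\otimes\varepsilon_C$ and comultiplication $(\mathrm{id}\otimes W\otimes\mathrm{id})(\rho\otimes\Delta_C)(\mathrm{id}\otimes\Delta_C)$. *Cross product bialgebras.* If $(R,\sigma)$ affords a crossed product, $(W,\rho)$ affords a crossed coproduct, and the comultiplication and the counit of the latter are unital algebra maps on the former, the resulting bialgebra is the cross product bialgebra $A{}_{W}^{\rho}\bowtie_{R}^{\sigma}C$. It is a left $A$-module by $a'\cdot(a\otimes c)=a'a\otimes c$ and a right $C$-comodule by $a\otimes c\mapsto(a\otimes c_1)\otimes c_2$. Two cross product bialgebras on the same $(A,\varepsilon_A)$, $(C,1_C)$ are equivalent if there is a linear isomorphism $A{}_{W'}^{\rho'}\bowtie_{R'}^{\sigma'}C\to A{}_{W}^{\rho}\bowtie_{R}^{\sigma}C$ that is a morphism of bialgebras, of left $A$-modules and of right $C$-comodules. **Theorem.** Let $A$ be a bialgebra with counit $\varepsilon_A$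 and comultiplication $a\mapsto a_1\otimes a_2$, and let $C$ be a coalgebra with a distinguished element $1_C$. Put $W_0(a\otimes c)=c\otimes a$ and $\rho_0(a\otimes c)=a_1\otimes a_2\,\varepsilon_C(c)$, and let $R,\sigma$ be such that $A{}_{W_0}^{\rho_0}\bowtie_{R}^{\sigma}C$ is a cross product bialgebra (its coalgebra is then the tensor product coalgebra $A\otimes C$). For linear maps $R':C\otimes A\to A\otimes C$, $\sigma':C\otimes C\to A\otimes C$, $W':A\otimes C\to C\otimes A$, $\rho':A\otimes C\to A\otimes A$ the following are equivalent: (i) $A{}_{W'}^{\rho'}\bowtie_{R'}^{\sigma'}C$ is a cross product bialgebra and it is equivalent to $A{}_{W_0}^{\rho_0}\bowtie_{R}^{\sigma}C$; (ii) there are linear maps $\theta,\gamma:C\to A\otimes C$, written $\theta(c)=c_{<-1>}\otimes c_{<0>}$ and $\gamma(c)=c_{\{-1\}}\otimes c_{\{0\}}$, such that for all $a\in A$, $c\in C$ $$R'=(\mu_2\otimes\mathrm{id})(\mathrm{id}\otimes\mathrm{id}\otimes\gamma)(\mathrm{id}\otimes R)(\theta\otimes\mathrm{id}),$$ $$\sigma'=(\mu\otimes\mathrm{id})(\mathrm{id}\otimes\gamma)(\mu_2\otimes\mathrm{id})(\mathrm{id}\otimes\mathrm{id}\otimes\sigma)(\mathrm{id}\otimes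 R\otimes\mathrm{id})(\theta\otimes\theta),$$ $$\theta(1_C)=1_A\otimes 1_C=\gamma(1_C),$$ $$c_{<-1>}c_{<0>_{\{-1\}}}\otimes c_{<0>_{\{0\}}}=1_A\otimes c=c_{\{-1\}}c_{\{0\}_{<-1>}}\otimes c_{\{0\}_{<0>}},$$ $$(\mu\otimes\mathrm{id})(\mu\otimes\sigma')(\mathrm{id}\otimes\gamma\otimes\mathrm{id})(R\otimes\mathrm{id})(\mathrm{id}\otimes\gamma)=(\mu\otimes\mathrm{id})(\mathrm{id}\otimes\gamma)\sigma,$$ $$W'(a\otimes c)=\varepsilon_A(c_{<0>_{1_{\{-1\}}}})\,\varepsilon_C(c_{<0>_{2_{\{0\}}}})\,c_{<0>_{1_{\{0\}}}}\otimes a\,c_{<-1>}c_{<0>_{2_{\{-1\}}}},$$ $$\rho'(a\otimes c)=\varepsilon_C(c_{<0>_{\{0\}_{\{0\}}}})\,a_1c_{<-1>_1}c_{<0>_{\{-1\}}}\otimes a_2c_{<-1>_2}c_{<0>_{\{0\}_{\{-1\}}}},$$ $$\varepsilon_A(c_{<-1>})\varepsilon_C(c_{<0>})=\varepsilon_C(c)=\varepsilon_A(c_{\{-1\}})\varepsilon_C(c_{\{0\}}),$$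 $$c_{<-1>}\otimes c_{<0>_1}\otimes c_{<0>_2}=c_{1_{<-1>}}\otimes c_{1_{<0>}}\otimes c_2,$$ $$c_{\{-1\}}\otimes c_{\{0\}_1}\otimes c_{\{0\}_2}=c_{1_{\{-1\}}}\otimes c_{1_{\{0\}}}\otimes c_2.$$ -/

import Mathlib

open scoped TensorProduct

namespace CrossProd

noncomputable section

/-! ### Crossed products of algebras -/

section Algebra

variable {k A V : Type*} [Field k] [Ring A] [Algebra k A] [AddCommGroup V] [Module k V]

/-- The canonical left action `A ⊗ (A ⊗ V) → A ⊗ V`, `a' ⊗ (a ⊗ v) ↦ a' a ⊗ v`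
(that is, `μ ⊗ id_V`). -/
def leftAct (k A V : Type*) [Field k] [Ring A] [Algebra k A] [AddCommGroup V] [Module k V] :
    A ⊗[k] (A ⊗[k] V) →ₗ[k] A ⊗[k] V :=
  (LinearMap.mul' k A).rTensor V ∘ₗ (TensorProduct.assoc k A A V).symm.toLinearMap

/-- For `θ : V → A ⊗ V`, `θ v = v₍₋₁₎ ⊗ v₍₀₎`, the map `(μ ⊗ id) ∘ (id ⊗ θ)`, that is
`A ⊗ V → A ⊗ V`, `a ⊗ v ↦ a v₍₋₁₎ ⊗ v₍₀₎`. -/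
def leftExtend (θ : V →ₗ[k] A ⊗[k] V) : A ⊗[k] V →ₗ[k] A ⊗[k] V :=
  leftAct k A V ∘ₗ θ.lTensor A

/-- The map `(μ ⊗ id) ∘ (id ⊗ σ) ∘ (R ⊗ id) : V ⊗ (A ⊗ V) → A ⊗ V`,
`v ⊗ (a ⊗ w) ↦ a_R σ(v_R, w)`. -/
def cross (R : V ⊗[k] A →ₗ[k] A ⊗[k] V) (σ : V ⊗[k] V →ₗ[k] A ⊗[k] V) :
    V ⊗[k] (A ⊗[k] V) →ₗ[k] A ⊗[k] V :=
  leftAct k A V ∘ₗ σ.lTensor A ∘ₗ (TensorProduct.assoc k A V V).toLinearMap ∘ₗ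
    R.rTensor V ∘ₗ (TensorProduct.assoc k V A V).symm.toLinearMap

/-- The multiplication of the crossed product `A ⊗_{R,σ} V`:
`(a ⊗ v) (a' ⊗ v') = a a'_R σ₁(v_R, v') ⊗ σ₂(v_R, v')`. -/
def mul (R : V ⊗[k] A →ₗ[k] A ⊗[k] V) (σ : V ⊗[k] V →ₗ[k] A ⊗[k] V) :
    (A ⊗[k] V) ⊗[k] (A ⊗[k] V) →ₗ[k] A ⊗[k] V :=
  leftAct k A V ∘ₗ (cross R σ).lTensor A ∘ₗ (TensorProduct.assoc k A V (A ⊗[k] V)).toLinearMap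

/-- The data `(A, V, R, σ)`, with `oneV` the distinguished element of `V`, affords a
(Brzeziński) crossed product. -/
structure IsCrossedProduct (oneV : V) (R : V ⊗[k] A →ₗ[k] A ⊗[k] V)
    (σ : V ⊗[k] V →ₗ[k] A ⊗[k] V) : Prop where
  /-- `R(1_V ⊗ a) = a ⊗ 1_V` -/
  R_one_left : ∀ a : A, R (oneV ⊗ₜ[k] a) = a ⊗ₜ[k] oneV
  /-- `R(v ⊗ 1_A) = 1_A ⊗ v` -/
  R_one_right : ∀ v : V, R (v ⊗ₜ[k] (1 : A)) = (1 : A) ⊗ₜ[k] v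
  /-- `σ(1_V, v) = 1_A ⊗ v` -/
  sigma_one_left : ∀ v : V, σ (oneV ⊗ₜ[k] v) = (1 : A) ⊗ₜ[k] v
  /-- `σ(v, 1_V) = 1_A ⊗ v` -/
  sigma_one_right : ∀ v : V, σ (v ⊗ₜ[k] oneV) = (1 : A) ⊗ₜ[k] v
  /-- `R ∘ (id ⊗ μ) = (μ ⊗ id) ∘ (id ⊗ R) ∘ (R ⊗ id)` -/
  R_mul : R ∘ₗ (LinearMap.mul' k A).lTensor V =
    leftAct k A V ∘ₗ R.lTensor A ∘ₗ (TensorProduct.assoc k A V A).toLinearMap ∘ₗ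
      R.rTensor A ∘ₗ (TensorProduct.assoc k V A A).symm.toLinearMap
  /-- `(μ ⊗ id) ∘ (id ⊗ σ) ∘ (R ⊗ id) ∘ (id ⊗ σ) = (μ ⊗ id) ∘ (id ⊗ σ) ∘ (σ ⊗ id)` -/
  sigma_sigma : cross R σ ∘ₗ σ.lTensor V =
    leftAct k A V ∘ₗ σ.lTensor A ∘ₗ (TensorProduct.assoc k A V V).toLinearMap ∘ₗ
      σ.rTensor V ∘ₗ (TensorProduct.assoc k V V V).symm.toLinearMap
  /-- `(μ ⊗ id) ∘ (id ⊗ σ) ∘ (R ⊗ id) ∘ (id ⊗ R) = (μ ⊗ id) ∘ (id ⊗ R) ∘ (σ ⊗ id)` -/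
  R_sigma : cross R σ ∘ₗ R.lTensor V =
    leftAct k A V ∘ₗ R.lTensor A ∘ₗ (TensorProduct.assoc k A V A).toLinearMap ∘ₗ
      σ.rTensor A ∘ₗ (TensorProduct.assoc k V V A).symm.toLinearMap

end Algebra

/-! ### Crossed coproducts of coalgebras -/

section Coalgebra

variable {k X C : Type*} [Field k] [AddCommGroup X] [Module k X]
  [AddCommGroup C] [Module k C] [Coalgebra k C]

/-- The canonical right coaction `X ⊗ C → (X ⊗ C) ⊗ C`, `x ⊗ c ↦ (x ⊗ c₁) ⊗ c₂`. -/
def rightCoact (k X C : Type*) [Field k] [AddCommGroup X] [Module k X]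
    [AddCommGroup C] [Module k C] [Coalgebra k C] :
    X ⊗[k] C →ₗ[k] (X ⊗[k] C) ⊗[k] C :=
  (TensorProduct.assoc k X C C).symm.toLinearMap ∘ₗ (Coalgebra.comul (R := k) (A := C)).lTensor X

/-- The functional `ε_X ⊗ ε_C` on `X ⊗ C`. -/
def counit (εX : X →ₗ[k] k) : X ⊗[k] C →ₗ[k] k :=
  LinearMap.mul' k k ∘ₗ TensorProduct.map εX (Coalgebra.counit (R := k) (A := C))

/-- The comultiplication `(id ⊗ W ⊗ id) ∘ (ρ ⊗ Δ_C) ∘ (id ⊗ Δ_C)` of the crossed coproduct: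
`x ⊗ c ↦ (ρ₁(x, c₁) ⊗ c₂_W) ⊗ (ρ₂(x, c₁)_W ⊗ c₃)`. -/
def comul (W : X ⊗[k] C →ₗ[k] C ⊗[k] X) (ρ : X ⊗[k] C →ₗ[k] X ⊗[k] X) :
    X ⊗[k] C →ₗ[k] (X ⊗[k] C) ⊗[k] (X ⊗[k] C) :=
  (TensorProduct.assoc k X C (X ⊗[k] C)).symm.toLinearMap ∘ₗ
    ((TensorProduct.assoc k C X C).toLinearMap ∘ₗ W.rTensor C ∘ₗ
      (TensorProduct.assoc k X C C).symm.toLinearMap).lTensor X ∘ₗ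
    (TensorProduct.assoc k X X (C ⊗[k] C)).toLinearMap ∘ₗ
    TensorProduct.map ρ (Coalgebra.comul (R := k) (A := C)) ∘ₗ rightCoact k X C

/-- The data `(X, C, W, ρ)`, with `εX` the distinguished functional on `X`, affords a
crossed coproduct. -/
structure IsCrossedCoproduct (εX : X →ₗ[k] k) (W : X ⊗[k] C →ₗ[k] C ⊗[k] X)
    (ρ : X ⊗[k] C →ₗ[k] X ⊗[k] X) : Prop where
  /-- `(id_C ⊗ ε_X) ∘ W = ε_X ⊗ id_C` -/
  W_counit_right : ∀ (x : X) (c : C),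
    TensorProduct.rid k C (εX.lTensor C (W (x ⊗ₜ[k] c))) = εX x • c
  /-- `(ε_C ⊗ id_X) ∘ W = id_X ⊗ ε_C` -/
  W_counit_left : ∀ (x : X) (c : C),
    TensorProduct.lid k X ((Coalgebra.counit (R := k) (A := C)).rTensor X (W (x ⊗ₜ[k] c))) =
      Coalgebra.counit (R := k) c • x
  /-- `(id_X ⊗ ε_X) ∘ ρ = id_X ⊗ ε_C` -/
  rho_counit_right : ∀ (x : X) (c : C),
    TensorProduct.rid k X (εX.lTensor X (ρ (x ⊗ₜ[k] c))) = Coalgebra.counit (R := k) c • x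
  /-- `(ε_X ⊗ id_X) ∘ ρ = id_X ⊗ ε_C` -/
  rho_counit_left : ∀ (x : X) (c : C),
    TensorProduct.lid k X (εX.rTensor X (ρ (x ⊗ₜ[k] c))) = Coalgebra.counit (R := k) c • x
  /-- `(Δ_C ⊗ id) ∘ W = (id ⊗ W) ∘ (W ⊗ id) ∘ (id ⊗ Δ_C)` -/
  comul_W : (TensorProduct.assoc k C C X).toLinearMap ∘ₗ
      (Coalgebra.comul (R := k) (A := C)).rTensor X ∘ₗ W =
    W.lTensor C ∘ₗ (TensorProduct.assoc k C X C).toLinearMap ∘ₗ W.rTensor C ∘ₗ rightCoact k X C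
  /-- `(ρ ⊗ id) ∘ (id ⊗ W) ∘ (ρ ⊗ id) ∘ (id ⊗ Δ_C) = (id ⊗ ρ) ∘ (ρ ⊗ id) ∘ (id ⊗ Δ_C)` -/
  rho_rho : (TensorProduct.assoc k X X X).toLinearMap ∘ₗ ρ.rTensor X ∘ₗ
      (TensorProduct.assoc k X C X).symm.toLinearMap ∘ₗ W.lTensor X ∘ₗ
      (TensorProduct.assoc k X X C).toLinearMap ∘ₗ ρ.rTensor C ∘ₗ rightCoact k X C =
    ρ.lTensor X ∘ₗ (TensorProduct.assoc k X X C).toLinearMap ∘ₗ ρ.rTensor C ∘ₗ rightCoact k X C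
  /-- `(W ⊗ id) ∘ (id ⊗ W) ∘ (ρ ⊗ id) ∘ (id ⊗ Δ_C) = (id ⊗ ρ) ∘ (W ⊗ id) ∘ (id ⊗ Δ_C)` -/
  W_rho : (TensorProduct.assoc k C X X).toLinearMap ∘ₗ W.rTensor X ∘ₗ
      (TensorProduct.assoc k X C X).symm.toLinearMap ∘ₗ W.lTensor X ∘ₗ
      (TensorProduct.assoc k X X C).toLinearMap ∘ₗ ρ.rTensor C ∘ₗ rightCoact k X C =
    ρ.lTensor C ∘ₗ (TensorProduct.assoc k C X C).toLinearMap ∘ₗ W.rTensor C ∘ₗ rightCoact k X C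

end Coalgebra

/-! ### Cross product bialgebras and their equivalence -/

section Bialgebra

variable {k A C : Type*} [Field k] [Ring A] [Algebra k A]
  [AddCommGroup C] [Module k C] [Coalgebra k C]

/-- The crossed product algebra `A ⊗_{R,σ} C` and the crossed coproduct coalgebra
`A_{W,ρ} ⊗ C` together form a bialgebra: the counit `ε_A ⊗ ε_C` and the comultiplication are
algebra maps. -/
structure IsCrossProductBialgebra (εA : A →ₗ[k] k) (oneC : C)
    (R : C ⊗[k] A →ₗ[k] A ⊗[k] C) (σ : C ⊗[k] C →ₗ[k] A ⊗[k] C)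
    (W : A ⊗[k] C →ₗ[k] C ⊗[k] A) (ρ : A ⊗[k] C →ₗ[k] A ⊗[k] A) : Prop where
  isCrossedProduct : IsCrossedProduct oneC R σ
  isCrossedCoproduct : IsCrossedCoproduct εA W ρ
  counit_one : counit εA ((1 : A) ⊗ₜ[k] oneC) = 1
  counit_mul : ∀ x y : A ⊗[k] C,
    counit εA (mul R σ (x ⊗ₜ[k] y)) = counit εA x * counit εA y
  comul_one : comul W ρ ((1 : A) ⊗ₜ[k] oneC) =
    ((1 : A) ⊗ₜ[k] oneC) ⊗ₜ[k] ((1 : A) ⊗ₜ[k] oneC)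
  /-- Multiplicativity of the comultiplication `Δ`, for the multiplication
  `(x ⊗ x') (y ⊗ y') = x y ⊗ x' y'` on the target. -/
  comul_mul : comul W ρ ∘ₗ mul R σ =
    TensorProduct.map (mul R σ) (mul R σ) ∘ₗ
      (TensorProduct.tensorTensorTensorComm k
        (A ⊗[k] C) (A ⊗[k] C) (A ⊗[k] C) (A ⊗[k] C)).toLinearMap ∘ₗ
      TensorProduct.map (comul W ρ) (comul W ρ)

/-- There is a linear isomorphism from the cross product bialgebra given by `(R', σ', W', ρ')`
to the one given by `(R, σ, W, ρ)` which is a morphism of algebras, of coalgebras, of left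
`A`-modules and of right `C`-comodules. -/
def Equivalent (εA : A →ₗ[k] k) (oneC : C)
    (R' : C ⊗[k] A →ₗ[k] A ⊗[k] C) (σ' : C ⊗[k] C →ₗ[k] A ⊗[k] C)
    (W' : A ⊗[k] C →ₗ[k] C ⊗[k] A) (ρ' : A ⊗[k] C →ₗ[k] A ⊗[k] A)
    (R : C ⊗[k] A →ₗ[k] A ⊗[k] C) (σ : C ⊗[k] C →ₗ[k] A ⊗[k] C)
    (W : A ⊗[k] C →ₗ[k] C ⊗[k] A) (ρ : A ⊗[k] C →ₗ[k] A ⊗[k] A) : Prop :=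
  ∃ φ : A ⊗[k] C ≃ₗ[k] A ⊗[k] C,
    φ ((1 : A) ⊗ₜ[k] oneC) = (1 : A) ⊗ₜ[k] oneC ∧
    (∀ x y : A ⊗[k] C, φ (mul R' σ' (x ⊗ₜ[k] y)) = mul R σ (φ x ⊗ₜ[k] φ y)) ∧
    (∀ x : A ⊗[k] C, counit εA (φ x) = counit εA x) ∧
    (∀ x : A ⊗[k] C, comul W ρ (φ x) =
      TensorProduct.map φ.toLinearMap φ.toLinearMap (comul W' ρ' x)) ∧
    (∀ (a : A) (x : A ⊗[k] C),
      φ (leftAct k A C (a ⊗ₜ[k] x)) = leftAct k A C (a ⊗ₜ[k] φ x)) ∧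
    (∀ x : A ⊗[k] C, rightCoact k A C (φ x) =
      φ.toLinearMap.rTensor C (rightCoact k A C x))

end Bialgebra

/-! ### The data of the tensor product coalgebra, and the twisting conditions -/

section Twist

variable {k A C : Type*} [Field k] [Ring A] [Bialgebra k A]
  [AddCommGroup C] [Module k C] [Coalgebra k C]

/-- `W₀ : A ⊗ C → C ⊗ A`, `a ⊗ c ↦ c ⊗ a`. -/
def W₀ (k A C : Type*) [Field k] [Ring A] [Bialgebra k A]
    [AddCommGroup C] [Module k C] [Coalgebra k C] : A ⊗[k] C →ₗ[k] C ⊗[k] A :=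
  (TensorProduct.comm k A C).toLinearMap

/-- `ρ₀ : A ⊗ C → A ⊗ A`, `a ⊗ c ↦ a₁ ⊗ a₂ ε_C(c)`. -/
def ρ₀ (k A C : Type*) [Field k] [Ring A] [Bialgebra k A]
    [AddCommGroup C] [Module k C] [Coalgebra k C] : A ⊗[k] C →ₗ[k] A ⊗[k] A :=
  Coalgebra.comul (R := k) (A := A) ∘ₗ (TensorProduct.rid k A).toLinearMap ∘ₗ
    (Coalgebra.counit (R := k) (A := C)).lTensor A

/-- For `γ c = c₍₋₁₎ ⊗ c₍₀₎`, the map `C → C`, `c ↦ ε_A(c₍₋₁₎) c₍₀₎`. -/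
def counitLeft (γ : C →ₗ[k] A ⊗[k] C) : C →ₗ[k] C :=
  (TensorProduct.lid k C).toLinearMap ∘ₗ (Coalgebra.counit (R := k) (A := A)).rTensor C ∘ₗ γ

/-- For `γ c = c₍₋₁₎ ⊗ c₍₀₎`, the map `C → A`, `c ↦ ε_C(c₍₀₎) c₍₋₁₎`. -/
def counitRight (γ : C →ₗ[k] A ⊗[k] C) : C →ₗ[k] A :=
  (TensorProduct.rid k A).toLinearMap ∘ₗ (Coalgebra.counit (R := k) (A := C)).lTensor A ∘ₗ γ

/-- The conditions relating the algebra data `(R', σ')` and `(R, σ)` through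
`θ c = c_<-1> ⊗ c_<0>` and `γ c = c_{-1} ⊗ c_{0}`. -/
structure AlgebraTwist (oneC : C) (θ γ : C →ₗ[k] A ⊗[k] C)
    (R' : C ⊗[k] A →ₗ[k] A ⊗[k] C) (σ' : C ⊗[k] C →ₗ[k] A ⊗[k] C)
    (R : C ⊗[k] A →ₗ[k] A ⊗[k] C) (σ : C ⊗[k] C →ₗ[k] A ⊗[k] C) : Prop where
  /-- `R' = (μ₂ ⊗ id) ∘ (id ⊗ id ⊗ γ) ∘ (id ⊗ R) ∘ (θ ⊗ id)` -/
  R_eq : R' = leftAct k A C ∘ₗ (leftExtend γ ∘ₗ R).lTensor A ∘ₗ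
    (TensorProduct.assoc k A C A).toLinearMap ∘ₗ θ.rTensor A
  /-- `σ' = (μ ⊗ id) ∘ (id ⊗ γ) ∘ (μ₂ ⊗ id) ∘ (id ⊗ id ⊗ σ) ∘ (id ⊗ R ⊗ id) ∘ (θ ⊗ θ)` -/
  sigma_eq : σ' = leftExtend γ ∘ₗ mul R σ ∘ₗ TensorProduct.map θ θ
  /-- `θ(1_C) = 1_A ⊗ 1_C` -/
  theta_one : θ oneC = (1 : A) ⊗ₜ[k] oneC
  /-- `γ(1_C) = 1_A ⊗ 1_C` -/
  gamma_one : γ oneC = (1 : A) ⊗ₜ[k] oneC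
  /-- `c_<-1> c_<0>_{-1} ⊗ c_<0>_{0} = 1_A ⊗ c` -/
  theta_gamma : ∀ c : C, leftExtend γ (θ c) = (1 : A) ⊗ₜ[k] c
  /-- `c_{-1} c_{0}_<-1> ⊗ c_{0}_<0> = 1_A ⊗ c` -/
  gamma_theta : ∀ c : C, leftExtend θ (γ c) = (1 : A) ⊗ₜ[k] c
  /-- `(μ ⊗ id) ∘ (μ ⊗ σ') ∘ (id ⊗ γ ⊗ id) ∘ (R ⊗ id) ∘ (id ⊗ γ) = (μ ⊗ id) ∘ (id ⊗ γ) ∘ σ` -/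
  gamma_sigma : leftAct k A C ∘ₗ σ'.lTensor A ∘ₗ (TensorProduct.assoc k A C C).toLinearMap ∘ₗ
      (leftExtend γ).rTensor C ∘ₗ R.rTensor C ∘ₗ
      (TensorProduct.assoc k C A C).symm.toLinearMap ∘ₗ γ.lTensor C =
    leftExtend γ ∘ₗ σ

/-- The conditions on `W'`, `ρ'`, `θ c = c_<-1> ⊗ c_<0>` and `γ c = c_{-1} ⊗ c_{0}`
concerning the coalgebra structures. -/
structure CoalgebraTwist (θ γ : C →ₗ[k] A ⊗[k] C)
    (W' : A ⊗[k] C →ₗ[k] C ⊗[k] A) (ρ' : A ⊗[k] C →ₗ[k] A ⊗[k] A) : Prop where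
  /-- `W'(a ⊗ c) = ε_A(c_<0>₁_{-1}) ε_C(c_<0>₂_{0}) c_<0>₁_{0} ⊗ a c_<-1> c_<0>₂_{-1}` -/
  W_eq : ∀ (a : A) (c : C), W' (a ⊗ₜ[k] c) =
    (LinearMap.mul' k A).lTensor C (TensorProduct.leftComm k A C A
      ((TensorProduct.map (counitLeft γ) (counitRight γ) ∘ₗ
        Coalgebra.comul (R := k) (A := C)).lTensor A (leftAct k A C (a ⊗ₜ[k] θ c))))
  /-- `ρ'(a ⊗ c) = ε_C(c_<0>_{0}_{0}) a₁ c_<-1>₁ c_<0>_{-1} ⊗ a₂ c_<-1>₂ c_<0>_{0}_{-1}` -/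
  rho_eq : ∀ (a : A) (c : C), ρ' (a ⊗ₜ[k] c) =
    Coalgebra.comul (R := k) a *
      LinearMap.mul' k (A ⊗[k] A) (TensorProduct.map (Coalgebra.comul (R := k) (A := A))
        ((counitRight γ).lTensor A ∘ₗ γ) (θ c))
  /-- `ε_A(c_<-1>) ε_C(c_<0>) = ε_C(c)` -/
  counit_theta : ∀ c : C,
    counit (Coalgebra.counit (R := k) (A := A)) (θ c) = Coalgebra.counit (R := k) c
  /-- `ε_A(c_{-1}) ε_C(c_{0}) = ε_C(c)` -/
  counit_gamma : ∀ c : C,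
    counit (Coalgebra.counit (R := k) (A := A)) (γ c) = Coalgebra.counit (R := k) c
  /-- `c_<-1> ⊗ c_<0>₁ ⊗ c_<0>₂ = c₁_<-1> ⊗ c₁_<0> ⊗ c₂` -/
  comul_theta : ∀ c : C,
    rightCoact k A C (θ c) = θ.rTensor C (Coalgebra.comul (R := k) c)
  /-- `c_{-1} ⊗ c_{0}₁ ⊗ c_{0}₂ = c₁_{-1} ⊗ c₁_{0} ⊗ c₂` -/
  comul_gamma : ∀ c : C,
    rightCoact k A C (γ c) = γ.rTensor C (Coalgebra.comul (R := k) c)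

end Twist

end

end CrossProd

/-! A crossed product on `A ⊗ C` amounts to an associative multiplication with unit `1 ⊗ 1_C` for
which left multiplication by `a ⊗ 1_C` is the standard `A`-action. The data are recovered as `R(c ⊗
a) = (1 ⊗ c)(a ⊗ 1_C)` and `σ(c ⊗ d) = (1 ⊗ c)(1 ⊗ d)` (`mul_assoc`, `isCrossedProduct_of_assoc`,
`mul_eq_of_assoc`). Dually, write `p = id ⊗ ε_C` and `q = ε_A ⊗ id`. A coassociative counital
comultiplication `D` with `(id ⊗ q) D` equal to the standard `C`-coaction gives a crossed coproduct
with `W = (q ⊗ p) D` and `ρ = (p ⊗ p) D` (`isCrossedCoproduct_of_coassoc`, `comul_eq_of_coassoc`).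
Conversely, these formulas recover `W` and `ρ` from their comultiplication (`W_eq_conv`,
`rho_eq_conv`).

As a left `A`-module `A ⊗ C` is free on `C`, so an `A`-linear automorphism `e` is the same as a pair
`θ = e(1 ⊗ -)`, `γ = e⁻¹(1 ⊗ -)` with mutually inverse extensions. In these terms, preservation of
unit and counit and colinearity are the side conditions of (ii). The formulas for `R'`, `σ'`, `W'`,
`ρ'` say that they are read off from the multiplication and comultiplication transported along `e`.
Since `e` is `A`-linear, `C`-colinear and preserves unit and counit, the transported structure again
has the standard action and coaction, so it is a cross product bialgebra. -/

namespace CrossProd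

noncomputable section

/-! ### Associativity of crossed products -/

section Algebra

variable {k A V : Type*} [Field k] [Ring A] [Algebra k A] [AddCommGroup V] [Module k V]

@[simp]
theorem leftAct_tmul (a b : A) (v : V) :
    leftAct k A V (a ⊗ₜ[k] (b ⊗ₜ[k] v)) = (a * b) ⊗ₜ[k] v := by
  simp [leftAct]

@[simp]
theorem leftAct_one (x : A ⊗[k] V) : leftAct k A V (1 ⊗ₜ[k] x) = x := by
  induction x with
  | zero => simp
  | tmul a v => simp
  | add x y hx hy => rw [TensorProduct.tmul_add, map_add, hx, hy]

theorem leftAct_leftAct (a b : A) (x : A ⊗[k] V) :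
    leftAct k A V (a ⊗ₜ[k] leftAct k A V (b ⊗ₜ[k] x)) = leftAct k A V ((a * b) ⊗ₜ[k] x) := by
  induction x with
  | zero => simp
  | tmul c v => simp [mul_assoc]
  | add x y hx hy => simp only [TensorProduct.tmul_add, map_add, hx, hy]

@[simp]
theorem leftExtend_tmul (θ : V →ₗ[k] A ⊗[k] V) (a : A) (v : V) :
    leftExtend θ (a ⊗ₜ[k] v) = leftAct k A V (a ⊗ₜ[k] θ v) := by
  simp [leftExtend]

theorem leftExtend_leftAct (θ : V →ₗ[k] A ⊗[k] V) (a : A) (x : A ⊗[k] V) :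
    leftExtend θ (leftAct k A V (a ⊗ₜ[k] x)) = leftAct k A V (a ⊗ₜ[k] leftExtend θ x) := by
  induction x with
  | zero => simp
  | tmul c v => simp [leftAct_leftAct]
  | add x y hx hy => simp only [TensorProduct.tmul_add, map_add, hx, hy]

variable {R : V ⊗[k] A →ₗ[k] A ⊗[k] V} {σ : V ⊗[k] V →ₗ[k] A ⊗[k] V}

@[simp]
theorem mul_tmul (a : A) (v : V) (y : A ⊗[k] V) :
    mul R σ ((a ⊗ₜ[k] v) ⊗ₜ[k] y) = leftAct k A V (a ⊗ₜ[k] cross R σ (v ⊗ₜ[k] y)) := by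
  simp [mul]

theorem mul_leftAct (a : A) (x y : A ⊗[k] V) :
    mul R σ (leftAct k A V (a ⊗ₜ[k] x) ⊗ₜ[k] y) = leftAct k A V (a ⊗ₜ[k] mul R σ (x ⊗ₜ[k] y)) := by
  induction x with
  | zero => simp
  | tmul c v => simp [leftAct_leftAct]
  | add x x' hx hy => simp only [TensorProduct.tmul_add, TensorProduct.add_tmul, map_add, hx, hy]

/-- The map `a ⊗ v ↦ a σ(v, u)`. -/
def actRight (σ : V ⊗[k] V →ₗ[k] A ⊗[k] V) (u : V) : A ⊗[k] V →ₗ[k] A ⊗[k] V :=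
  leftExtend (σ ∘ₗ (TensorProduct.mk k V V).flip u)

theorem actRight_tmul (a : A) (u v : V) :
    actRight σ u (a ⊗ₜ[k] v) = leftAct k A V (a ⊗ₜ[k] σ (v ⊗ₜ[k] u)) := by
  simp [actRight]

theorem leftAct_lTensor_assoc (u : V) (x : A ⊗[k] V) :
    leftAct k A V (σ.lTensor A (TensorProduct.assoc k A V V (x ⊗ₜ[k] u))) = actRight σ u x := by
  induction x with
  | zero => simp
  | tmul c v => simp [actRight_tmul]
  | add x y hx hy => simp only [TensorProduct.add_tmul, map_add, hx, hy]

theorem cross_tmul (v u : V) (a : A) :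
    cross R σ (v ⊗ₜ[k] (a ⊗ₜ[k] u)) = actRight σ u (R (v ⊗ₜ[k] a)) := by
  simp [cross, leftAct_lTensor_assoc]

/-- The map `a ⊗ v ↦ a R(v, b)`. -/
def actRightA (R : V ⊗[k] A →ₗ[k] A ⊗[k] V) (b : A) : A ⊗[k] V →ₗ[k] A ⊗[k] V :=
  leftExtend (R ∘ₗ (TensorProduct.mk k V A).flip b)

theorem actRightA_tmul (a b : A) (v : V) :
    actRightA R b (a ⊗ₜ[k] v) = leftAct k A V (a ⊗ₜ[k] R (v ⊗ₜ[k] b)) := by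
  simp [actRightA]

theorem leftAct_lTensor_assocA (b : A) (x : A ⊗[k] V) :
    leftAct k A V (R.lTensor A (TensorProduct.assoc k A V A (x ⊗ₜ[k] b))) = actRightA R b x := by
  induction x with
  | zero => simp
  | tmul c v => simp [actRightA_tmul]
  | add x y hx hy => simp only [TensorProduct.add_tmul, map_add, hx, hy]

namespace IsCrossedProduct

variable {oneV : V} (h : IsCrossedProduct oneV R σ)
include h

theorem R_mul_apply (v : V) (a b : A) :
    R (v ⊗ₜ[k] (a * b)) = actRightA R b (R (v ⊗ₜ[k] a)) := by
  simpa [leftAct_lTensor_assocA] using LinearMap.congr_fun h.R_mul (v ⊗ₜ[k] (a ⊗ₜ[k] b))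

theorem sigma_sigma_apply (v w u : V) :
    cross R σ (v ⊗ₜ[k] σ (w ⊗ₜ[k] u)) = actRight σ u (σ (v ⊗ₜ[k] w)) := by
  simpa [leftAct_lTensor_assoc] using LinearMap.congr_fun h.sigma_sigma (v ⊗ₜ[k] (w ⊗ₜ[k] u))

theorem R_sigma_apply (v w : V) (a : A) :
    cross R σ (v ⊗ₜ[k] R (w ⊗ₜ[k] a)) = actRightA R a (σ (v ⊗ₜ[k] w)) := by
  simpa [leftAct_lTensor_assocA] using LinearMap.congr_fun h.R_sigma (v ⊗ₜ[k] (w ⊗ₜ[k] a))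

theorem one_mul (y : A ⊗[k] V) : mul R σ ((1 ⊗ₜ[k] oneV) ⊗ₜ[k] y) = y := by
  induction y with
  | zero => simp
  | tmul a v => simp [cross_tmul, h.R_one_left, actRight_tmul, h.sigma_one_left]
  | add x y hx hy => simp only [TensorProduct.tmul_add, map_add, hx, hy]

theorem mul_one (y : A ⊗[k] V) : mul R σ (y ⊗ₜ[k] (1 ⊗ₜ[k] oneV)) = y := by
  induction y with
  | zero => simp
  | tmul a v => simp [cross_tmul, h.R_one_right, actRight_tmul, h.sigma_one_right]
  | add x y hx hy => simp only [TensorProduct.add_tmul, map_add, hx, hy]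

theorem tmul_one_mul (a : A) (y : A ⊗[k] V) :
    mul R σ ((a ⊗ₜ[k] oneV) ⊗ₜ[k] y) = leftAct k A V (a ⊗ₜ[k] y) := by
  have := mul_leftAct (R := R) (σ := σ) a (1 ⊗ₜ[k] oneV) y
  rwa [leftAct_tmul, _root_.mul_one, h.one_mul] at this

theorem cross_inclA (v : V) (a : A) : cross R σ (v ⊗ₜ[k] (a ⊗ₜ[k] oneV)) = R (v ⊗ₜ[k] a) := by
  rw [cross_tmul]
  induction R (v ⊗ₜ[k] a) with
  | zero => simp
  | tmul a v => simp [actRight_tmul, h.sigma_one_right]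
  | add x y hx hy => simp only [map_add, hx, hy]

theorem mul_inclV (v : V) (x : A ⊗[k] V) :
    mul R σ (x ⊗ₜ[k] (1 ⊗ₜ[k] v)) = actRight σ v x := by
  induction x with
  | zero => simp
  | tmul a w => simp [cross_tmul, h.R_one_right, actRight_tmul]
  | add x y hx hy => simp only [TensorProduct.add_tmul, map_add, hx, hy]

/-- `cross R σ (v ⊗ y)` is the product `(1 ⊗ v) y`, so this is associativity for the triple `1 ⊗ v`,
`b ⊗ 1_V`, `y`. It encodes the axiom `R_mul`. -/
theorem cross_leftAct (v : V) (b : A) (y : A ⊗[k] V) :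
    cross R σ (v ⊗ₜ[k] leftAct k A V (b ⊗ₜ[k] y)) = mul R σ (R (v ⊗ₜ[k] b) ⊗ₜ[k] y) := by
  induction y with
  | zero => simp
  | tmul c u =>
    rw [leftAct_tmul, cross_tmul, h.R_mul_apply]
    induction R (v ⊗ₜ[k] b) with
    | zero => simp
    | tmul a w => simp [actRightA_tmul, cross_tmul, actRight, leftExtend_leftAct]
    | add x y hx hy => simp only [TensorProduct.add_tmul, map_add, hx, hy]
  | add x y hx hy => simp only [TensorProduct.tmul_add, map_add, hx, hy]

/-- Associativity for `1 ⊗ v`, `1 ⊗ w`, `z`. Factor `z = c ⊗ u` as `(c ⊗ 1_V)(1 ⊗ u)`: the axiom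
`R_sigma` handles `c`, and `sigma_sigma` handles `u`. -/
theorem cross_cross (v w : V) (z : A ⊗[k] V) :
    cross R σ (v ⊗ₜ[k] cross R σ (w ⊗ₜ[k] z)) = mul R σ (σ (v ⊗ₜ[k] w) ⊗ₜ[k] z) := by
  induction z with
  | zero => simp
  | tmul c u =>
    -- Left multiplication by `1 ⊗ v` commutes with right multiplication by `1 ⊗ u`. The coefficient
    -- of `x` is first moved past `v` by `R`, which leaves `sigma_sigma`.
    have h₁ : ∀ x : A ⊗[k] V, cross R σ (v ⊗ₜ[k] actRight σ u x) =
        actRight σ u (cross R σ (v ⊗ₜ[k] x)) := by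
      intro x
      induction x with
      | zero => simp
      | tmul a w =>
        rw [actRight_tmul, h.cross_leftAct, cross_tmul]
        induction R (v ⊗ₜ[k] a) with
        | zero => simp
        | tmul b t =>
          rw [mul_tmul, h.sigma_sigma_apply, actRight_tmul]
          simp only [actRight, leftExtend_leftAct]
        | add x y hx hy => simp only [TensorProduct.add_tmul, map_add, hx, hy]
      | add x y hx hy => simp only [TensorProduct.tmul_add, map_add, hx, hy]
    rw [cross_tmul, h₁, h.R_sigma_apply]
    induction σ (v ⊗ₜ[k] w) with
    | zero => simp
    | tmul b t =>
      rw [mul_tmul, actRightA_tmul, cross_tmul]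
      simp only [actRight, leftExtend_leftAct]
    | add x y hx hy => simp only [TensorProduct.add_tmul, map_add, hx, hy]
  | add x y hx hy => simp only [TensorProduct.tmul_add, map_add, hx, hy]

theorem cross_mul (v : V) (y z : A ⊗[k] V) :
    cross R σ (v ⊗ₜ[k] mul R σ (y ⊗ₜ[k] z)) = mul R σ (cross R σ (v ⊗ₜ[k] y) ⊗ₜ[k] z) := by
  induction y with
  | zero => simp
  | tmul b w =>
    rw [mul_tmul, h.cross_leftAct, cross_tmul]
    induction R (v ⊗ₜ[k] b) with
    | zero => simp
    | tmul a t => rw [mul_tmul, h.cross_cross, actRight_tmul, mul_leftAct]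
    | add x y hx hy => simp only [TensorProduct.add_tmul, map_add, hx, hy]
  | add x y hx hy => simp only [TensorProduct.tmul_add, TensorProduct.add_tmul, map_add, hx, hy]

/-- The multiplication of a crossed product is associative. -/
theorem mul_assoc (x y z : A ⊗[k] V) :
    mul R σ (mul R σ (x ⊗ₜ[k] y) ⊗ₜ[k] z) = mul R σ (x ⊗ₜ[k] mul R σ (y ⊗ₜ[k] z)) := by
  induction x with
  | zero => simp
  | tmul a v => rw [mul_tmul, mul_tmul, mul_leftAct, h.cross_mul]
  | add x x' hx hy => simp only [TensorProduct.add_tmul, map_add, hx, hy]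

end IsCrossedProduct

/-! ### From an associative multiplication to crossed product data -/

section OfAssoc

variable {oneV : V} {m : (A ⊗[k] V) ⊗[k] (A ⊗[k] V) →ₗ[k] A ⊗[k] V}
  (hassoc : ∀ x y z, m (m (x ⊗ₜ[k] y) ⊗ₜ[k] z) = m (x ⊗ₜ[k] m (y ⊗ₜ[k] z)))
  (hone : ∀ x, m (x ⊗ₜ[k] ((1 : A) ⊗ₜ[k] oneV)) = x)
  (hact : ∀ a x, m ((a ⊗ₜ[k] oneV) ⊗ₜ[k] x) = leftAct k A V (a ⊗ₜ[k] x))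
  (hR : ∀ v a, R (v ⊗ₜ[k] a) = m (((1 : A) ⊗ₜ[k] v) ⊗ₜ[k] (a ⊗ₜ[k] oneV)))
  (hσ : ∀ v w, σ (v ⊗ₜ[k] w) = m (((1 : A) ⊗ₜ[k] v) ⊗ₜ[k] ((1 : A) ⊗ₜ[k] w)))

include hassoc hact hσ in
theorem actRight_eq_of_assoc (u : V) (x : A ⊗[k] V) :
    actRight σ u x = m (x ⊗ₜ[k] ((1 : A) ⊗ₜ[k] u)) := by
  induction x with
  | zero => simp
  | tmul a v => rw [actRight_tmul, hσ, ← hact, ← hassoc, hact, leftAct_tmul, mul_one]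
  | add x y hx hy => simp only [TensorProduct.add_tmul, map_add, hx, hy]

include hassoc hact hR in
theorem actRightA_eq_of_assoc (b : A) (x : A ⊗[k] V) :
    actRightA R b x = m (x ⊗ₜ[k] (b ⊗ₜ[k] oneV)) := by
  induction x with
  | zero => simp
  | tmul a v => rw [actRightA_tmul, hR, ← hact, ← hassoc, hact, leftAct_tmul, mul_one]
  | add x y hx hy => simp only [TensorProduct.add_tmul, map_add, hx, hy]

-- Regroup `(1 ⊗ v)((a ⊗ 1)(1 ⊗ w))` as `((1 ⊗ v)(a ⊗ 1))(1 ⊗ w)`: the inner product is `R`, and the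
-- outer one is expressed through `σ`.
include hassoc hact hR hσ in
theorem cross_eq_of_assoc (v : V) (y : A ⊗[k] V) :
    cross R σ (v ⊗ₜ[k] y) = m (((1 : A) ⊗ₜ[k] v) ⊗ₜ[k] y) := by
  induction y with
  | zero => simp
  | tmul a w =>
    rw [cross_tmul, actRight_eq_of_assoc hassoc hact hσ, hR, hassoc, hact, leftAct_tmul, mul_one]
  | add x y hx hy => simp only [TensorProduct.tmul_add, map_add, hx, hy]

include hassoc hact hR hσ in
theorem mul_eq_of_assoc : mul R σ = m := by
  refine TensorProduct.ext' fun x y => ?_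
  induction x with
  | zero => simp
  | tmul a v =>
    rw [mul_tmul, cross_eq_of_assoc hassoc hact hR hσ, ← hact, ← hassoc, hact, leftAct_tmul,
      mul_one]
  | add x y hx hy => simp only [TensorProduct.add_tmul, map_add, hx, hy]

include hassoc hone hact hR hσ in
/-- A unital associative multiplication on `A ⊗ V` extending the left action of `A` affords a
crossed product. -/
theorem isCrossedProduct_of_assoc : IsCrossedProduct oneV R σ where
  R_one_left a := by rw [hR, hact, leftAct_one]
  R_one_right v := by rw [hR, hone]
  sigma_one_left v := by rw [hσ, hact, leftAct_one]
  sigma_one_right v := by rw [hσ, hone]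
  R_mul := by
    ext v a b
    have : m ((a ⊗ₜ[k] oneV) ⊗ₜ[k] (b ⊗ₜ[k] oneV)) = (a * b) ⊗ₜ[k] oneV := by
      rw [hact, leftAct_tmul]
    simp [leftAct_lTensor_assocA, actRightA_eq_of_assoc hassoc hact hR, hR, hassoc, this]
  sigma_sigma := by
    ext v w u
    simp [leftAct_lTensor_assoc, actRight_eq_of_assoc hassoc hact hσ,
      cross_eq_of_assoc hassoc hact hR hσ, hσ, hassoc]
  R_sigma := by
    ext v w a
    simp [leftAct_lTensor_assocA, actRightA_eq_of_assoc hassoc hact hR,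
      cross_eq_of_assoc hassoc hact hR hσ, hσ, hR, hassoc]

end OfAssoc

end Algebra

/-! ### Sweedler calculus for a coassociative map -/

section Conv

open TensorProduct

variable {k B X Y Z X' Y' : Type*} [Field k] [AddCommGroup B] [Module k B]
  [AddCommGroup X] [Module k X] [AddCommGroup Y] [Module k Y] [AddCommGroup Z] [Module k Z]
  [AddCommGroup X'] [Module k X'] [AddCommGroup Y'] [Module k Y']

/-- The map `b ↦ f(b₁) ⊗ g(b₂)` for a comultiplication `D b = b₁ ⊗ b₂`. -/
def conv (D : B →ₗ[k] B ⊗[k] B) (f : B →ₗ[k] X) (g : B →ₗ[k] Y) : B →ₗ[k] X ⊗[k] Y :=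
  TensorProduct.map f g ∘ₗ D

variable {D : B →ₗ[k] B ⊗[k] B} (f : B →ₗ[k] X) (g : B →ₗ[k] Y)

theorem map_comp_conv (u : X →ₗ[k] X') (v : Y →ₗ[k] Y') :
    TensorProduct.map u v ∘ₗ conv D f g = conv D (u ∘ₗ f) (v ∘ₗ g) := by
  rw [conv, conv, TensorProduct.map_comp, LinearMap.comp_assoc]

theorem rTensor_comp_conv (u : X →ₗ[k] X') : u.rTensor Y ∘ₗ conv D f g = conv D (u ∘ₗ f) g := by
  rw [LinearMap.rTensor, map_comp_conv, LinearMap.id_comp]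

theorem lTensor_comp_conv (v : Y →ₗ[k] Y') : v.lTensor X ∘ₗ conv D f g = conv D f (v ∘ₗ g) := by
  rw [LinearMap.lTensor, map_comp_conv, LinearMap.id_comp]

variable (hD : (TensorProduct.assoc k B B B).toLinearMap ∘ₗ D.rTensor B ∘ₗ D = D.lTensor B ∘ₗ D)

-- Coassociativity together with naturality of the associator. With it, composites of `W`, `ρ` and
-- coactions become rebracketings of a single iterated comultiplication.
include hD in
theorem assoc_comp_conv (e : B →ₗ[k] Z) :
    (TensorProduct.assoc k X Y Z).toLinearMap ∘ₗ conv D (conv D f g) e =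
      conv D f (conv D g e) := by
  have h₁ : conv D (conv D f g) e = map (map f g) e ∘ₗ D.rTensor B ∘ₗ D := by
    rw [conv, conv, ← LinearMap.comp_assoc, LinearMap.map_comp_rTensor]
  have h₂ : conv D f (conv D g e) = map f (map g e) ∘ₗ D.lTensor B ∘ₗ D := by
    rw [conv, conv, ← LinearMap.comp_assoc, LinearMap.map_comp_lTensor]
  rw [h₁, h₂, ← hD, ← LinearMap.comp_assoc, ← LinearMap.comp_assoc, ← LinearMap.comp_assoc,
    ← LinearMap.comp_assoc, TensorProduct.map_map_comp_assoc_eq]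

include hD in
theorem assoc_symm_comp_conv (e : B →ₗ[k] Z) :
    (TensorProduct.assoc k X Y Z).symm.toLinearMap ∘ₗ conv D f (conv D g e) =
      conv D (conv D f g) e := by
  rw [← assoc_comp_conv f g hD, ← LinearMap.comp_assoc, LinearEquiv.symm_comp, LinearMap.id_comp]

end Conv

/-! ### From a comultiplication to crossed coproduct data -/

section Coalgebra

variable {k X C : Type*} [Field k] [AddCommGroup X] [Module k X]
  [AddCommGroup C] [Module k C] [Coalgebra k C]

/-- The projection `id ⊗ ε_C : X ⊗ C → X`. -/
def projLeft (k X C : Type*) [Field k] [AddCommGroup X] [Module k X]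
    [AddCommGroup C] [Module k C] [Coalgebra k C] : X ⊗[k] C →ₗ[k] X :=
  (TensorProduct.rid k X).toLinearMap ∘ₗ (Coalgebra.counit (R := k) (A := C)).lTensor X

/-- The projection `ε_X ⊗ id : X ⊗ C → C`. -/
def projRight (εX : X →ₗ[k] k) : X ⊗[k] C →ₗ[k] C :=
  (TensorProduct.lid k C).toLinearMap ∘ₗ εX.rTensor C

@[simp]
theorem projLeft_tmul (x : X) (c : C) :
    projLeft k X C (x ⊗ₜ[k] c) = Coalgebra.counit (R := k) c • x := by
  simp [projLeft]

omit [Coalgebra k C] in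
@[simp]
theorem projRight_tmul (εX : X →ₗ[k] k) (x : X) (c : C) :
    projRight εX (x ⊗ₜ[k] c) = εX x • c := by
  simp [projRight]

@[simp]
theorem counit_tmul (εX : X →ₗ[k] k) (x : X) (c : C) :
    counit εX (x ⊗ₜ[k] c) = εX x * Coalgebra.counit (R := k) c := by
  simp [counit]

theorem comp_projLeft (εX : X →ₗ[k] k) : εX ∘ₗ projLeft k X C = counit εX := by
  ext x c
  simp [mul_comm]

theorem counit_comp_projRight (εX : X →ₗ[k] k) :
    Coalgebra.counit ∘ₗ projRight (C := C) εX = counit εX := by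
  ext x c
  simp

theorem rTensor_projLeft_rightCoact (b : X ⊗[k] C) :
    (projLeft k X C).rTensor C (rightCoact k X C b) = b := by
  induction b with
  | zero => simp
  | tmul x c =>
    let r := Coalgebra.Repr.arbitrary k c
    have h := Coalgebra.sum_counit_smul (R := k) r
    simp only [rightCoact, LinearMap.comp_apply, LinearMap.lTensor_tmul, ← r.eq, TensorProduct.tmul_sum,
      map_sum, LinearEquiv.coe_coe, TensorProduct.assoc_symm_tmul, LinearMap.rTensor_tmul,
      projLeft_tmul, TensorProduct.smul_tmul]
    rw [← TensorProduct.tmul_sum, h]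
  | add x y hx hy => rw [map_add, map_add, hx, hy]

theorem rTensor_projRight_rightCoact (εX : X →ₗ[k] k) :
    (projRight εX).rTensor C ∘ₗ rightCoact k X C = Coalgebra.comul ∘ₗ projRight (C := C) εX := by
  refine TensorProduct.ext' fun x c => ?_
  let r := Coalgebra.Repr.arbitrary k c
  simp [rightCoact, ← r.eq, TensorProduct.tmul_sum, Finset.smul_sum, TensorProduct.smul_tmul']

/-- Expresses `projRight` through counit and coaction alone, so a colinear map preserving the counit
also preserves `projRight`. -/
theorem rTensor_counit_rightCoact (εX : X →ₗ[k] k) (b : X ⊗[k] C) :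
    TensorProduct.lid k C ((counit εX).rTensor C (rightCoact k X C b)) = projRight εX b := by
  rw [← comp_projLeft, LinearMap.rTensor_comp_apply, rTensor_projLeft_rightCoact]
  rfl

section OfCoassoc

variable {εX : X →ₗ[k] k} {D : X ⊗[k] C →ₗ[k] (X ⊗[k] C) ⊗[k] (X ⊗[k] C)}
  (hD : (TensorProduct.assoc k (X ⊗[k] C) (X ⊗[k] C) (X ⊗[k] C)).toLinearMap ∘ₗ
    D.rTensor _ ∘ₗ D = D.lTensor _ ∘ₗ D)
  (hleft : ∀ b, TensorProduct.lid k _ ((counit εX).rTensor _ (D b)) = b)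
  (hright : ∀ b, TensorProduct.rid k _ ((counit εX).lTensor _ (D b)) = b)
  (hcoact : conv D LinearMap.id (projRight εX) = rightCoact k X C)
  {W : X ⊗[k] C →ₗ[k] C ⊗[k] X} {ρ : X ⊗[k] C →ₗ[k] X ⊗[k] X}
  (hW : W = conv D (projRight εX) (projLeft k X C))
  (hρ : ρ = conv D (projLeft k X C) (projLeft k X C))

-- Apply `p ⊗ id` to `hcoact`. This is the cancellation rule `p(b₁) ⊗ q(b₂) = b`, which merges
-- adjacent legs in the computations below.
include hcoact in
theorem conv_projLeft_projRight :
    conv D (projLeft k X C) (projRight εX) = LinearMap.id := by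
  have h := rTensor_comp_conv (D := D) LinearMap.id (projRight εX) (projLeft k X C)
  rw [LinearMap.comp_id, hcoact] at h
  rw [← h]
  exact LinearMap.ext rTensor_projLeft_rightCoact

include hcoact in
theorem comul_comp_projRight :
    Coalgebra.comul ∘ₗ projRight (C := C) εX = conv D (projRight εX) (projRight εX) := by
  rw [← rTensor_projRight_rightCoact, ← hcoact, rTensor_comp_conv, LinearMap.comp_id]

omit [Coalgebra k C] in
theorem lid_map_apply {B Y : Type*} [AddCommGroup B] [Module k B] [AddCommGroup Y] [Module k Y]
    (ε : B →ₗ[k] k) (g : B →ₗ[k] Y) (t : B ⊗[k] B) :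
    TensorProduct.lid k Y (TensorProduct.map ε g t) = g (TensorProduct.lid k B (ε.rTensor B t)) := by
  induction t with
  | zero => simp
  | tmul x y => simp
  | add x y hx hy => simp only [map_add, hx, hy]

theorem rid_map_apply {B Y : Type*} [AddCommGroup B] [Module k B] [AddCommGroup Y] [Module k Y]
    (ε : B →ₗ[k] k) (g : B →ₗ[k] Y) (t : B ⊗[k] B) :
    TensorProduct.rid k Y (TensorProduct.map g ε t) = g (TensorProduct.rid k B (ε.lTensor B t)) := by
  induction t with
  | zero => simp
  | tmul x y => simp
  | add x y hx hy => simp only [map_add, hx, hy]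

include hleft in
theorem lid_conv_counit {Y : Type*} [AddCommGroup Y] [Module k Y] (g : X ⊗[k] C →ₗ[k] Y)
    (b : X ⊗[k] C) : TensorProduct.lid k Y (conv D (counit εX) g b) = g b := by
  rw [conv, LinearMap.comp_apply, lid_map_apply, hleft]

include hright in
theorem rid_conv_counit {Y : Type*} [AddCommGroup Y] [Module k Y] (g : X ⊗[k] C →ₗ[k] Y)
    (b : X ⊗[k] C) : TensorProduct.rid k Y (conv D g (counit εX) b) = g b := by
  rw [conv, LinearMap.comp_apply, rid_map_apply, hright]

-- In Sweedler notation for `D`, expanding `ρ`, the coaction and `Δ_C ∘ q` gives `p(b₁) ⊗ p(b₂) ⊗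
-- q(b₃) ⊗ q(b₄)`. The middle legs merge to `b₂`, and `W` turns them into `q ⊗ p`. Then `p(b₁) ⊗
-- q(b₂) ⊗ p(b₃) ⊗ q(b₄)` merges to `b₁ ⊗ b₂`.
include hD hcoact hW hρ in
theorem comul_eq_of_coassoc : comul W ρ = D := by
  have hid := conv_projLeft_projRight hcoact
  rw [comul, ← hcoact, map_comp_conv, LinearMap.comp_id, comul_comp_projRight hcoact, hρ,
    assoc_comp_conv _ _ hD, lTensor_comp_conv, LinearMap.comp_assoc, LinearMap.comp_assoc,
    assoc_symm_comp_conv _ _ hD, rTensor_comp_conv, hid, LinearMap.comp_id, hW,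
    assoc_comp_conv _ _ hD, assoc_symm_comp_conv _ _ hD, hid, conv, TensorProduct.map_id,
    LinearMap.id_comp]

-- The counit axioms follow from `ε_X ∘ p = ε_X ⊗ ε_C = ε_C ∘ q`. In each of the other three, both
-- sides reduce to the same threefold expression: `q ⊗ q ⊗ p` for `comul_W`, `p ⊗ p ⊗ p` for
-- `rho_rho`, `q ⊗ p ⊗ p` for `W_rho`.
include hD hleft hright hcoact hW hρ in
theorem isCrossedCoproduct_of_coassoc : IsCrossedCoproduct εX W ρ where
  W_counit_right x c := by
    rw [← LinearMap.comp_apply, hW, lTensor_comp_conv, comp_projLeft, rid_conv_counit hright,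
      projRight_tmul]
  W_counit_left x c := by
    rw [← LinearMap.comp_apply, hW, rTensor_comp_conv, counit_comp_projRight, lid_conv_counit hleft,
      projLeft_tmul]
  rho_counit_right x c := by
    rw [← LinearMap.comp_apply, hρ, lTensor_comp_conv, comp_projLeft, rid_conv_counit hright,
      projLeft_tmul]
  rho_counit_left x c := by
    rw [← LinearMap.comp_apply, hρ, rTensor_comp_conv, comp_projLeft, lid_conv_counit hleft,
      projLeft_tmul]
  comul_W := by
    have hid := conv_projLeft_projRight hcoact
    conv_rhs => rw [← hcoact, rTensor_comp_conv, LinearMap.comp_id, hW, assoc_comp_conv _ _ hD,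
      lTensor_comp_conv, hid, LinearMap.comp_id]
    rw [hW, rTensor_comp_conv, comul_comp_projRight hcoact, assoc_comp_conv _ _ hD]
  rho_rho := by
    have hid := conv_projLeft_projRight hcoact
    rw [← hcoact, rTensor_comp_conv, LinearMap.comp_id]
    conv_rhs => rw [hρ, assoc_comp_conv _ _ hD, lTensor_comp_conv, hid, LinearMap.comp_id]
    conv_lhs => rw [hρ, assoc_comp_conv _ _ hD, lTensor_comp_conv, hid, LinearMap.comp_id, hW,
      assoc_symm_comp_conv _ _ hD, rTensor_comp_conv, hid, LinearMap.comp_id,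
      assoc_comp_conv _ _ hD]
  W_rho := by
    have hid := conv_projLeft_projRight hcoact
    rw [← hcoact, rTensor_comp_conv, rTensor_comp_conv, LinearMap.comp_id, LinearMap.comp_id]
    conv_rhs => rw [hρ, hW, assoc_comp_conv _ _ hD, lTensor_comp_conv, hid, LinearMap.comp_id]
    conv_lhs => rw [hρ, assoc_comp_conv _ _ hD, lTensor_comp_conv, hid, LinearMap.comp_id, hW,
      assoc_symm_comp_conv _ _ hD, rTensor_comp_conv, hid, LinearMap.comp_id,
      assoc_comp_conv _ _ hD]

end OfCoassoc

end Coalgebra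

/-! ### Recovering `W` and `ρ` from their comultiplication -/

section Extraction

variable {k X C : Type*} [Field k] [AddCommGroup X] [Module k X]
  [AddCommGroup C] [Module k C] [Coalgebra k C]
  {εX : X →ₗ[k] k} {W : X ⊗[k] C →ₗ[k] C ⊗[k] X} {ρ : X ⊗[k] C →ₗ[k] X ⊗[k] X}

theorem comul_tmul (x : X) (c : C) {ι : Type*} (r : Coalgebra.Repr k c ι) :
    comul W ρ (x ⊗ₜ[k] c) = ∑ i ∈ r.index,
      (TensorProduct.assoc k X C (X ⊗[k] C)).symm
        (((TensorProduct.assoc k C X C).toLinearMap ∘ₗ W.rTensor C ∘ₗ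
          (TensorProduct.assoc k X C C).symm.toLinearMap).lTensor X
          (TensorProduct.assoc k X X (C ⊗[k] C)
            (ρ (x ⊗ₜ[k] r.left i) ⊗ₜ[k] Coalgebra.comul (r.right i)))) := by
  simp only [comul, rightCoact, LinearMap.comp_apply, LinearMap.lTensor_tmul, ← r.eq,
    TensorProduct.tmul_sum, map_sum, LinearEquiv.coe_coe, TensorProduct.assoc_symm_tmul,
    TensorProduct.map_tmul]

/-- Applying `ε_C` to the `C`-leg produced by `W` collapses `W`, by `hW`. -/
theorem map_projLeft_projLeft
    (hW : ∀ (x : X) (c : C), TensorProduct.lid k X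
      ((Coalgebra.counit (R := k) (A := C)).rTensor X (W (x ⊗ₜ[k] c))) =
        Coalgebra.counit (R := k) c • x) (u : X ⊗[k] X) (v : C ⊗[k] C) :
    TensorProduct.map (projLeft k X C) (projLeft k X C)
      ((TensorProduct.assoc k X C (X ⊗[k] C)).symm
        (((TensorProduct.assoc k C X C).toLinearMap ∘ₗ W.rTensor C ∘ₗ
          (TensorProduct.assoc k X C C).symm.toLinearMap).lTensor X
          (TensorProduct.assoc k X X (C ⊗[k] C) (u ⊗ₜ[k] v)))) =
    Coalgebra.counit (R := k) (TensorProduct.rid k C (Coalgebra.counit.lTensor C v)) • u := by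
  induction u with
  | zero => simp
  | add u u' hu hu' => simp only [TensorProduct.add_tmul, map_add, hu, hu', smul_add]
  | tmul x y =>
    induction v with
    | zero => simp
    | add v v' hv hv' => simp only [TensorProduct.tmul_add, map_add, hv, hv', add_smul]
    | tmul c d =>
      have h : ∀ t : C ⊗[k] X, TensorProduct.map (projLeft k X C) (projLeft k X C)
          ((TensorProduct.assoc k X C (X ⊗[k] C)).symm
            (x ⊗ₜ[k] TensorProduct.assoc k C X C (t ⊗ₜ[k] d))) =
          Coalgebra.counit (R := k) d •
            (x ⊗ₜ[k] TensorProduct.lid k X (Coalgebra.counit.rTensor X t)) := by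
        intro t
        induction t with
        | zero => simp
        | tmul e z => simp [TensorProduct.smul_tmul, smul_smul]
        | add t t' ht ht' =>
          simp only [TensorProduct.add_tmul, TensorProduct.tmul_add, map_add, ht, ht', smul_add]
      simp [h, hW, smul_smul]

theorem map_projRight_projLeft (u : X ⊗[k] X) (v : C ⊗[k] C) :
    TensorProduct.map (projRight εX) (projLeft k X C)
      ((TensorProduct.assoc k X C (X ⊗[k] C)).symm
        (((TensorProduct.assoc k C X C).toLinearMap ∘ₗ W.rTensor C ∘ₗ
          (TensorProduct.assoc k X C C).symm.toLinearMap).lTensor X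
          (TensorProduct.assoc k X X (C ⊗[k] C) (u ⊗ₜ[k] v)))) =
    W (TensorProduct.lid k X (εX.rTensor X u) ⊗ₜ[k]
      TensorProduct.rid k C (Coalgebra.counit.lTensor C v)) := by
  induction u with
  | zero => simp
  | add u u' hu hu' => simp only [TensorProduct.add_tmul, map_add, hu, hu']
  | tmul x y =>
    induction v with
    | zero => simp
    | add v v' hv hv' => simp only [TensorProduct.tmul_add, map_add, hv, hv']
    | tmul c d =>
      have h : ∀ t : C ⊗[k] X, TensorProduct.map (projRight εX) (projLeft k X C)
          ((TensorProduct.assoc k X C (X ⊗[k] C)).symm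
            (x ⊗ₜ[k] TensorProduct.assoc k C X C (t ⊗ₜ[k] d))) =
          εX x • Coalgebra.counit (R := k) d • t := by
        intro t
        induction t with
        | zero => simp
        | tmul e z => simp [TensorProduct.smul_tmul', smul_comm (εX x)]
        | add t t' ht ht' =>
          simp only [TensorProduct.add_tmul, TensorProduct.tmul_add, map_add, ht, ht', smul_add]
      simp [h, ← TensorProduct.smul_tmul', smul_comm (εX x)]

/-- Only the two outer legs of the comultiplication are killed by counits. `ρ` then disappears by
`rho_counit_left`, and `W` survives in the middle. -/
theorem IsCrossedCoproduct.W_eq_conv (h : IsCrossedCoproduct εX W ρ) :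
    W = conv (comul W ρ) (projRight εX) (projLeft k X C) := by
  refine TensorProduct.ext' fun x c => ?_
  let r := Coalgebra.Repr.arbitrary k c
  have hc := Coalgebra.sum_counit_smul (R := k) r
  rw [conv, LinearMap.comp_apply, comul_tmul x c r, map_sum]
  simp only [map_projRight_projLeft, h.rho_counit_left, Coalgebra.lTensor_counit_comul,
    TensorProduct.rid_tmul, one_smul, TensorProduct.smul_tmul]
  rw [← map_sum, ← TensorProduct.tmul_sum, hc]

theorem IsCrossedCoproduct.rho_eq_conv (h : IsCrossedCoproduct εX W ρ) :
    ρ = conv (comul W ρ) (projLeft k X C) (projLeft k X C) := by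
  refine TensorProduct.ext' fun x c => ?_
  let r := Coalgebra.Repr.arbitrary k c
  have hc : ∑ i ∈ r.index, Coalgebra.counit (R := k) (r.right i) • r.left i = c := by
    simpa [-Coalgebra.sum_tmul_counit_eq] using congrArg (TensorProduct.rid k C)
      (Coalgebra.sum_tmul_counit_eq (R := k) r)
  rw [conv, LinearMap.comp_apply, comul_tmul x c r, map_sum]
  simp only [map_projLeft_projLeft h.W_counit_left, Coalgebra.lTensor_counit_comul,
    TensorProduct.rid_tmul, one_smul]
  simp only [← map_smul, ← TensorProduct.tmul_smul]
  rw [← map_sum, ← TensorProduct.tmul_sum, hc]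

end Extraction

/-! ### The tensor product coalgebra and `A`-linear extensions -/

section Twist

variable {k A C : Type*} [Field k] [Ring A] [Bialgebra k A]
  [AddCommGroup C] [Module k C] [Coalgebra k C]

/-- Makes coassociativity and the counit laws of the untwisted structure available from the
coalgebra instance on `A ⊗ C`. -/
theorem comul_W₀_ρ₀ : comul (W₀ k A C) (ρ₀ k A C) = Coalgebra.comul (R := k) (A := A ⊗[k] C) := by
  refine TensorProduct.ext' fun a c => ?_
  let r := Coalgebra.Repr.arbitrary k c
  have hc := Coalgebra.sum_counit_smul (R := k) r
  have hρ : ∀ d, ρ₀ k A C (a ⊗ₜ[k] d) = Coalgebra.counit (R := k) d • Coalgebra.comul a := by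
    intro d
    simp [ρ₀]
  rw [comul_tmul a c r]
  simp only [hρ, TensorProduct.smul_tmul]
  simp only [← map_smul]
  rw [← map_sum, ← map_sum, ← map_sum, ← TensorProduct.tmul_sum, ← map_sum, hc,
    TensorProduct.comul_tmul]
  induction Coalgebra.comul (R := k) a with
  | zero => simp
  | add x y hx hy => simp only [TensorProduct.add_tmul, map_add, hx, hy]
  | tmul a b =>
    induction Coalgebra.comul (R := k) c with
    | zero => simp
    | add x y hx hy => simp only [TensorProduct.tmul_add, map_add, hx, hy]
    | tmul c d => simp [W₀]

theorem counit_counit : counit (C := C) (Coalgebra.counit (R := k) (A := A)) =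
    Coalgebra.counit (R := k) (A := A ⊗[k] C) := by
  ext a c
  simp [mul_comm]

theorem conv_comul_projRight :
    conv (Coalgebra.comul (R := k) (A := A ⊗[k] C)) LinearMap.id
      (projRight (Coalgebra.counit (R := k) (A := A))) = rightCoact k A C := by
  refine TensorProduct.ext' fun a c => ?_
  have ha := Coalgebra.lTensor_counit_comul (R := k) a
  rw [conv, LinearMap.comp_apply, TensorProduct.comul_tmul, rightCoact, LinearMap.comp_apply,
    LinearMap.lTensor_tmul]
  have h : ∀ (u : A ⊗[k] A) (v : C ⊗[k] C),
      TensorProduct.map LinearMap.id (projRight (Coalgebra.counit (R := k) (A := A)))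
        (TensorProduct.tensorTensorTensorComm k A A C C (u ⊗ₜ[k] v)) =
      (TensorProduct.assoc k A C C).symm
        (TensorProduct.rid k A (Coalgebra.counit.lTensor A u) ⊗ₜ[k] v) := by
    intro u v
    induction u with
    | zero => simp
    | add x y hx hy => simp only [TensorProduct.add_tmul, map_add, hx, hy]
    | tmul a b =>
      induction v with
      | zero => simp
      | add x y hx hy => simp only [TensorProduct.tmul_add, map_add, hx, hy]
      | tmul c d => simp [TensorProduct.smul_tmul]
  refine (h _ _).trans ?_
  rw [ha]
  simp

theorem counit_leftAct (a : A) (x : A ⊗[k] C) :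
    counit (Coalgebra.counit (R := k) (A := A)) (leftAct k A C (a ⊗ₜ[k] x)) =
      Coalgebra.counit (R := k) a * counit (Coalgebra.counit (R := k) (A := A)) x := by
  induction x with
  | zero => simp
  | tmul b c => simp [mul_assoc]
  | add x y hx hy => simp only [TensorProduct.tmul_add, map_add, hx, hy, mul_add]

omit [Coalgebra k C] in
theorem projRight_leftAct (a : A) (x : A ⊗[k] C) :
    projRight (Coalgebra.counit (R := k) (A := A)) (leftAct k A C (a ⊗ₜ[k] x)) =
      Coalgebra.counit (R := k) a • projRight (Coalgebra.counit (R := k) (A := A)) x := by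
  induction x with
  | zero => simp
  | tmul b c => simp [smul_smul]
  | add x y hx hy => simp only [TensorProduct.tmul_add, map_add, hx, hy, smul_add]

theorem projLeft_leftAct (a : A) (x : A ⊗[k] C) :
    projLeft k A C (leftAct k A C (a ⊗ₜ[k] x)) = a * projLeft k A C x := by
  induction x with
  | zero => simp
  | tmul b c => simp
  | add x y hx hy => simp only [TensorProduct.tmul_add, map_add, hx, hy, mul_add]

theorem rightCoact_leftAct (a : A) (x : A ⊗[k] C) :
    rightCoact k A C (leftAct k A C (a ⊗ₜ[k] x)) =
      (leftAct k A C ∘ₗ TensorProduct.mk k A (A ⊗[k] C) a).rTensor C (rightCoact k A C x) := by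
  induction x with
  | zero => simp
  | tmul b c =>
    simp only [leftAct_tmul, rightCoact, LinearMap.comp_apply, LinearMap.lTensor_tmul]
    induction Coalgebra.comul (R := k) c with
    | zero => simp
    | tmul b c => simp
    | add x y hx hy => simp only [TensorProduct.tmul_add, map_add, hx, hy]
  | add x y hx hy => simp only [TensorProduct.tmul_add, map_add, hx, hy]

variable {θ γ : C →ₗ[k] A ⊗[k] C}

theorem counit_leftExtend (hθ : ∀ c, counit (Coalgebra.counit (R := k) (A := A)) (θ c) =
    Coalgebra.counit (R := k) c) (x : A ⊗[k] C) :
    counit (Coalgebra.counit (R := k) (A := A)) (leftExtend θ x) =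
      counit (Coalgebra.counit (R := k) (A := A)) x := by
  induction x with
  | zero => simp
  | tmul b c => rw [leftExtend_tmul, counit_leftAct, hθ, counit_tmul]
  | add x y hx hy => rw [map_add, map_add, map_add, hx, hy]

theorem rightCoact_leftExtend (hθ : ∀ c, rightCoact k A C (θ c) =
    θ.rTensor C (Coalgebra.comul (R := k) c)) (x : A ⊗[k] C) :
    rightCoact k A C (leftExtend θ x) = (leftExtend θ).rTensor C (rightCoact k A C x) := by
  induction x with
  | zero => simp
  | tmul b c =>
    rw [leftExtend_tmul, rightCoact_leftAct, hθ]
    simp only [rightCoact, LinearMap.comp_apply, LinearMap.lTensor_tmul]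
    induction Coalgebra.comul (R := k) c with
    | zero => simp
    | tmul b c => simp
    | add x y hx hy => simp only [TensorProduct.tmul_add, map_add, hx, hy]
  | add x y hx hy => simp only [map_add, hx, hy]

/-- For `y = b ⊗ d`, the left leg sees `b₁` only through `ε_A`, so all of `b` ends up in the right
leg. This produces the formula for `W'`. -/
theorem map_projRight_projLeft_leftExtend (y : A ⊗[k] C) :
    TensorProduct.map
        (projRight (Coalgebra.counit (R := k) (A := A)) ∘ₗ leftExtend γ)
        (projLeft k A C ∘ₗ leftExtend γ) (Coalgebra.comul y) =
      (LinearMap.mul' k A).lTensor C (TensorProduct.leftComm k A C A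
        ((TensorProduct.map (counitLeft γ) (counitRight γ) ∘ₗ
          Coalgebra.comul (R := k) (A := C)).lTensor A y)) := by
  induction y with
  | zero => simp
  | add x y hx hy => simp only [map_add, hx, hy]
  | tmul b d =>
    have h : ∀ (u : A ⊗[k] A) (v : C ⊗[k] C), TensorProduct.map
        (projRight (Coalgebra.counit (R := k) (A := A)) ∘ₗ leftExtend γ)
        (projLeft k A C ∘ₗ leftExtend γ)
        (TensorProduct.tensorTensorTensorComm k A A C C (u ⊗ₜ[k] v)) =
        (LinearMap.mul' k A).lTensor C (TensorProduct.leftComm k A C A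
          (TensorProduct.lid k A (Coalgebra.counit.rTensor A u) ⊗ₜ[k]
            TensorProduct.map (counitLeft γ) (counitRight γ) v)) := by
      intro u v
      induction u with
      | zero => simp
      | add x y hx hy => simp only [TensorProduct.add_tmul, map_add, hx, hy]
      | tmul a b =>
        induction v with
        | zero => simp
        | add x y hx hy => simp only [TensorProduct.tmul_add, map_add, hx, hy]
        | tmul c d =>
          have h₁ : counitLeft γ c = projRight (Coalgebra.counit (R := k) (A := A)) (γ c) := rfl
          have h₂ : counitRight γ d = projLeft k A C (γ d) := rfl
          simp [projRight_leftAct, projLeft_leftAct, h₁, h₂, TensorProduct.smul_tmul]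
    rw [TensorProduct.comul_tmul]
    refine (h _ _).trans ?_
    simp

/-- Colinearity replaces `γ(d₁) ⊗ d₂` by the coaction of `γ(d)`, where `ε_C` cancels. Hence the
iterated `γ` in the formula for `ρ'`. -/
theorem map_counitRight_comul (hγ : ∀ c, rightCoact k A C (γ c) =
    γ.rTensor C (Coalgebra.comul (R := k) c)) (d : C) :
    TensorProduct.map (counitRight γ) (counitRight γ) (Coalgebra.comul (R := k) d) =
      (counitRight γ).lTensor A (γ d) := by
  have h := rTensor_projLeft_rightCoact (γ d)
  rw [hγ, ← LinearMap.rTensor_comp_apply] at h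
  rw [← LinearMap.lTensor_comp_rTensor, LinearMap.comp_apply]
  exact congrArg _ h

theorem map_projLeft_projLeft_leftExtend (hγ : ∀ c, rightCoact k A C (γ c) =
    γ.rTensor C (Coalgebra.comul (R := k) c)) (y : A ⊗[k] C) :
    TensorProduct.map (projLeft k A C ∘ₗ leftExtend γ)
        (projLeft k A C ∘ₗ leftExtend γ) (Coalgebra.comul y) =
      LinearMap.mul' k (A ⊗[k] A) (TensorProduct.map (Coalgebra.comul (R := k) (A := A))
        ((counitRight γ).lTensor A ∘ₗ γ) y) := by
  induction y with
  | zero => simp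
  | add x y hx hy => simp only [map_add, hx, hy]
  | tmul b d =>
    have h : ∀ (u : A ⊗[k] A) (v : C ⊗[k] C), TensorProduct.map
        (projLeft k A C ∘ₗ leftExtend γ) (projLeft k A C ∘ₗ leftExtend γ)
        (TensorProduct.tensorTensorTensorComm k A A C C (u ⊗ₜ[k] v)) =
        u * TensorProduct.map (counitRight γ) (counitRight γ) v := by
      intro u v
      induction u with
      | zero => simp
      | add x y hx hy => simp only [TensorProduct.add_tmul, map_add, hx, hy, add_mul]
      | tmul a b =>
        induction v with
        | zero => simp
        | add x y hx hy => simp only [TensorProduct.tmul_add, map_add, hx, hy, mul_add]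
        | tmul c d =>
          have h₂ : ∀ d, counitRight γ d = projLeft k A C (γ d) := fun _ => rfl
          simp [projLeft_leftAct, h₂]
    rw [TensorProduct.comul_tmul]
    refine (h _ _).trans ?_
    rw [map_counitRight_comul hγ]
    simp

omit [Coalgebra k C] in
theorem mul'_map_comul_leftAct (g : C →ₗ[k] A ⊗[k] A) (a : A) (x : A ⊗[k] C) :
    LinearMap.mul' k (A ⊗[k] A) (TensorProduct.map (Coalgebra.comul (R := k) (A := A)) g
      (leftAct k A C (a ⊗ₜ[k] x))) = Coalgebra.comul (R := k) a *
    LinearMap.mul' k (A ⊗[k] A) (TensorProduct.map (Coalgebra.comul (R := k) (A := A)) g x) := by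
  induction x with
  | zero => simp
  | tmul b c => simp [mul_assoc]
  | add x y hx hy => simp only [TensorProduct.tmul_add, map_add, hx, hy, mul_add]

end Twist

/-! ### Transport of structure along a linear automorphism -/

section Transport

variable {k B : Type*} [Field k] [AddCommGroup B] [Module k B]

/-- The multiplication `m` transported along `e`. -/
def transportMul (e : B ≃ₗ[k] B) (m : B ⊗[k] B →ₗ[k] B) : B ⊗[k] B →ₗ[k] B :=
  e.symm.toLinearMap ∘ₗ m ∘ₗ TensorProduct.map e.toLinearMap e.toLinearMap

/-- The comultiplication `D` transported along `e`. -/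
def transportComul (e : B ≃ₗ[k] B) (D : B →ₗ[k] B ⊗[k] B) : B →ₗ[k] B ⊗[k] B :=
  TensorProduct.map e.symm.toLinearMap e.symm.toLinearMap ∘ₗ D ∘ₗ e.toLinearMap

@[simp]
theorem transportMul_tmul (e : B ≃ₗ[k] B) (m : B ⊗[k] B →ₗ[k] B) (x y : B) :
    transportMul e m (x ⊗ₜ[k] y) = e.symm (m (e x ⊗ₜ[k] e y)) := by
  simp [transportMul]

@[simp]
theorem transportComul_apply (e : B ≃ₗ[k] B) (D : B →ₗ[k] B ⊗[k] B) (x : B) :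
    transportComul e D x =
      TensorProduct.map e.symm.toLinearMap e.symm.toLinearMap (D (e x)) := by
  simp [transportComul]

theorem transportComul_coassoc (e : B ≃ₗ[k] B) {D : B →ₗ[k] B ⊗[k] B}
    (hD : (TensorProduct.assoc k B B B).toLinearMap ∘ₗ D.rTensor B ∘ₗ D = D.lTensor B ∘ₗ D) :
    (TensorProduct.assoc k B B B).toLinearMap ∘ₗ (transportComul e D).rTensor B ∘ₗ
      transportComul e D = (transportComul e D).lTensor B ∘ₗ transportComul e D := by
  have he : e.toLinearMap ∘ₗ e.symm.toLinearMap = LinearMap.id := by ext; simp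
  have h : transportComul e D = conv D e.symm.toLinearMap e.symm.toLinearMap ∘ₗ e.toLinearMap := rfl
  have h' : transportComul e D ∘ₗ e.symm.toLinearMap =
      conv D e.symm.toLinearMap e.symm.toLinearMap := by
    rw [h, LinearMap.comp_assoc, he, LinearMap.comp_id]
  conv_lhs => rw [h, ← LinearMap.comp_assoc, ← LinearMap.comp_assoc,
    LinearMap.comp_assoc _ _ (TensorProduct.assoc k B B B).toLinearMap, ← h, rTensor_comp_conv, h',
    assoc_comp_conv _ _ hD]
  conv_rhs => rw [h, ← LinearMap.comp_assoc, ← h, lTensor_comp_conv, h']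

theorem transportComul_transportMul (e : B ≃ₗ[k] B) {m : B ⊗[k] B →ₗ[k] B}
    {D : B →ₗ[k] B ⊗[k] B}
    (h : D ∘ₗ m = TensorProduct.map m m ∘ₗ
      (TensorProduct.tensorTensorTensorComm k B B B B).toLinearMap ∘ₗ TensorProduct.map D D) :
    transportComul e D ∘ₗ transportMul e m =
      TensorProduct.map (transportMul e m) (transportMul e m) ∘ₗ
      (TensorProduct.tensorTensorTensorComm k B B B B).toLinearMap ∘ₗ
      TensorProduct.map (transportComul e D) (transportComul e D) := by
  refine TensorProduct.ext' fun x y => ?_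
  have hxy := LinearMap.congr_fun h (e x ⊗ₜ[k] e y)
  simp only [LinearMap.comp_apply, TensorProduct.map_tmul, LinearEquiv.coe_coe] at hxy ⊢
  rw [transportMul_tmul, transportComul_apply, transportComul_apply, transportComul_apply,
    LinearEquiv.apply_symm_apply, hxy]
  generalize D (e x) = u
  generalize D (e y) = v
  induction u with
  | zero => simp
  | add x y hx hy => simp only [TensorProduct.add_tmul, map_add, hx, hy]
  | tmul a b =>
    induction v with
    | zero => simp
    | add x y hx hy => simp only [TensorProduct.tmul_add, map_add, hx, hy]
    | tmul c d => simp

end Transport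

/-! ### The twisting formulas as transport of structure -/

section Twist

variable {k A C : Type*} [Field k] [Ring A] [Bialgebra k A]
  [AddCommGroup C] [Module k C] [Coalgebra k C]
  {oneC : C} {θ γ : C →ₗ[k] A ⊗[k] C}
  {R R' : C ⊗[k] A →ₗ[k] A ⊗[k] C} {σ σ' : C ⊗[k] C →ₗ[k] A ⊗[k] C}

-- When `leftExtend θ` and `leftExtend γ` are `e` and `e⁻¹` and `e` fixes `a ⊗ 1_C`, the right side
-- is `e⁻¹(e(1 ⊗ c) e(a ⊗ 1_C))`, the transported product.
omit [Coalgebra k C] in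
theorem IsCrossedProduct.twist_apply (h : IsCrossedProduct oneC R σ) (c : C) (a : A) :
    (leftAct k A C ∘ₗ (leftExtend γ ∘ₗ R).lTensor A ∘ₗ
      (TensorProduct.assoc k A C A).toLinearMap ∘ₗ θ.rTensor A) (c ⊗ₜ[k] a) =
      leftExtend γ (mul R σ (θ c ⊗ₜ[k] (a ⊗ₜ[k] oneC))) := by
  simp only [LinearMap.comp_apply, LinearMap.rTensor_tmul, LinearEquiv.coe_coe]
  induction θ c with
  | zero => simp
  | tmul b d => simp [h.cross_inclA, leftExtend_leftAct]
  | add x y hx hy => simp only [TensorProduct.add_tmul, map_add, hx, hy]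

-- For each term `b ⊗ f` of `γ d`, `hmul` moves `leftExtend γ` outside the product, leaving `(1 ⊗
-- c)(b ⊗ 1_C) θ(f)`. The last two factors reassemble to `leftExtend θ (γ d)`.
omit [Coalgebra k C] in
theorem IsCrossedProduct.twist_sigma_apply (h : IsCrossedProduct oneC R σ)
    (h' : IsCrossedProduct oneC R' σ')
    (hmul : ∀ x d, mul R' σ' (leftExtend γ x ⊗ₜ[k] ((1 : A) ⊗ₜ[k] d)) =
      leftExtend γ (mul R σ (x ⊗ₜ[k] θ d))) (c d : C) :
    (leftAct k A C ∘ₗ σ'.lTensor A ∘ₗ (TensorProduct.assoc k A C C).toLinearMap ∘ₗ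
      (leftExtend γ).rTensor C ∘ₗ R.rTensor C ∘ₗ
      (TensorProduct.assoc k C A C).symm.toLinearMap ∘ₗ γ.lTensor C) (c ⊗ₜ[k] d) =
    leftExtend γ (mul R σ ((1 ⊗ₜ[k] c) ⊗ₜ[k] leftExtend θ (γ d))) := by
  simp only [LinearMap.comp_apply, LinearMap.lTensor_tmul, LinearEquiv.coe_coe]
  induction γ d with
  | zero => simp
  | tmul b e =>
    rw [TensorProduct.assoc_symm_tmul, LinearMap.rTensor_tmul, LinearMap.rTensor_tmul,
      leftAct_lTensor_assoc, ← h'.mul_inclV, hmul, leftExtend_tmul, mul_tmul, leftAct_one,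
      h.cross_leftAct]
  | add x y hx hy => simp only [TensorProduct.tmul_add, map_add, hx, hy]

/-- The formulas for `W'` and `ρ'` say that `W'` and `ρ'` come from the transported
comultiplication. -/
theorem conv_transportComul_W (e : A ⊗[k] C ≃ₗ[k] A ⊗[k] C) (hθ : e.toLinearMap = leftExtend θ)
    (hγ : e.symm.toLinearMap = leftExtend γ) (a : A) (c : C) :
    conv (transportComul e Coalgebra.comul) (projRight (Coalgebra.counit (R := k) (A := A)))
      (projLeft k A C) (a ⊗ₜ[k] c) =
    (LinearMap.mul' k A).lTensor C (TensorProduct.leftComm k A C A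
      ((TensorProduct.map (counitLeft γ) (counitRight γ) ∘ₗ
        Coalgebra.comul (R := k) (A := C)).lTensor A (leftAct k A C (a ⊗ₜ[k] θ c)))) := by
  rw [← map_projRight_projLeft_leftExtend, ← leftExtend_tmul, ← hθ, ← hγ,
    TensorProduct.map_comp]
  rfl

theorem conv_transportComul_rho (e : A ⊗[k] C ≃ₗ[k] A ⊗[k] C) (hθ : e.toLinearMap = leftExtend θ)
    (hγ : e.symm.toLinearMap = leftExtend γ)
    (hcoact : ∀ c, rightCoact k A C (γ c) = γ.rTensor C (Coalgebra.comul (R := k) c))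
    (a : A) (c : C) :
    conv (transportComul e Coalgebra.comul) (projLeft k A C) (projLeft k A C) (a ⊗ₜ[k] c) =
    Coalgebra.comul (R := k) a *
      LinearMap.mul' k (A ⊗[k] A) (TensorProduct.map (Coalgebra.comul (R := k) (A := A))
        ((counitRight γ).lTensor A ∘ₗ γ) (θ c)) := by
  rw [← mul'_map_comul_leftAct, ← map_projLeft_projLeft_leftExtend hcoact, ← leftExtend_tmul,
    ← hθ, ← hγ, TensorProduct.map_comp]
  rfl

-- `A ⊗ C` is the free left `A`-module on `C`, so `f` is determined by its values on `1 ⊗ C`.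
omit [Coalgebra k C] in
theorem eq_leftExtend_of_leftAct {f : A ⊗[k] C →ₗ[k] A ⊗[k] C}
    (hf : ∀ (a : A) x, f (leftAct k A C (a ⊗ₜ[k] x)) = leftAct k A C (a ⊗ₜ[k] f x)) :
    f = leftExtend (f ∘ₗ TensorProduct.mk k A C 1) := by
  refine TensorProduct.ext' fun a c => ?_
  rw [leftExtend_tmul, LinearMap.comp_apply, ← hf]
  simp

theorem rightCoact_one_tmul (c : C) : rightCoact k A C (1 ⊗ₜ[k] c) =
    (TensorProduct.mk k A C 1).rTensor C (Coalgebra.comul (R := k) c) := by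
  simp only [rightCoact, LinearMap.comp_apply, LinearMap.lTensor_tmul]
  induction Coalgebra.comul (R := k) c with
  | zero => simp
  | tmul b c => simp
  | add x y hx hy => simp only [TensorProduct.tmul_add, map_add, hx, hy]

variable {W' : A ⊗[k] C →ₗ[k] C ⊗[k] A} {ρ' : A ⊗[k] C →ₗ[k] A ⊗[k] A}

theorem exists_twist_of_equivalent
    (h : IsCrossProductBialgebra (Coalgebra.counit (R := k) (A := A)) oneC R σ
      (W₀ k A C) (ρ₀ k A C))
    (h' : IsCrossProductBialgebra (Coalgebra.counit (R := k) (A := A)) oneC R' σ' W' ρ')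
    (he : Equivalent (Coalgebra.counit (R := k) (A := A)) oneC R' σ' W' ρ'
        R σ (W₀ k A C) (ρ₀ k A C)) :
    ∃ θ γ : C →ₗ[k] A ⊗[k] C, AlgebraTwist oneC θ γ R' σ' R σ ∧ CoalgebraTwist θ γ W' ρ' := by
  obtain ⟨e, hone, hmul, hcounit, hcomul, hact, hcoact⟩ := he
  have hA := h.isCrossedProduct
  have hA' := h'.isCrossedProduct
  let θ : C →ₗ[k] A ⊗[k] C := e.toLinearMap ∘ₗ TensorProduct.mk k A C 1
  let γ : C →ₗ[k] A ⊗[k] C := e.symm.toLinearMap ∘ₗ TensorProduct.mk k A C 1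
  have hθ : e.toLinearMap = leftExtend θ := eq_leftExtend_of_leftAct hact
  have hact' : ∀ (a : A) (x : A ⊗[k] C),
      e.symm (leftAct k A C (a ⊗ₜ[k] x)) = leftAct k A C (a ⊗ₜ[k] e.symm x) := fun a x => by
    rw [LinearEquiv.symm_apply_eq, hact, LinearEquiv.apply_symm_apply]
  have hγ : e.symm.toLinearMap = leftExtend γ := eq_leftExtend_of_leftAct hact'
  have hθ' : ∀ x, leftExtend θ x = e x := fun x => (LinearMap.congr_fun hθ x).symm
  have hγ' : ∀ x, leftExtend γ x = e.symm x := fun x => (LinearMap.congr_fun hγ x).symm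
  have hθc : ∀ c, θ c = e (1 ⊗ₜ[k] c) := fun _ => rfl
  have hγc : ∀ c, γ c = e.symm (1 ⊗ₜ[k] c) := fun _ => rfl
  have hcounit' : ∀ x, counit (Coalgebra.counit (R := k) (A := A)) (e.symm x) =
      counit (Coalgebra.counit (R := k) (A := A)) x := fun x => by
    rw [← hcounit, LinearEquiv.apply_symm_apply]
  have hcoact' : ∀ x, rightCoact k A C (e.symm x) =
      e.symm.toLinearMap.rTensor C (rightCoact k A C x) := fun x => by
    obtain ⟨y, rfl⟩ := e.surjective x
    rw [hcoact, ← LinearMap.rTensor_comp_apply, LinearEquiv.symm_comp]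
    simp
  have hD : comul W' ρ' = transportComul e (Coalgebra.comul (R := k) (A := A ⊗[k] C)) := by
    refine LinearMap.ext fun x => ?_
    rw [transportComul_apply, ← comul_W₀_ρ₀, hcomul, ← LinearMap.comp_apply,
      ← TensorProduct.map_comp, LinearEquiv.symm_comp, TensorProduct.map_id, LinearMap.id_apply]
  have hγcoact : ∀ c, rightCoact k A C (γ c) = γ.rTensor C (Coalgebra.comul (R := k) c) :=
    fun c => by
      rw [hγc, hcoact', rightCoact_one_tmul, ← LinearMap.rTensor_comp_apply]
  refine ⟨θ, γ, ⟨?_, ?_, ?_, ?_, ?_, ?_, ?_⟩, ⟨?_, ?_, ?_, ?_, ?_, hγcoact⟩⟩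
  · refine TensorProduct.ext' fun c a => ?_
    have h₁ : e (a ⊗ₜ[k] oneC) = a ⊗ₜ[k] oneC := by
      have := hact a (1 ⊗ₜ[k] oneC)
      rwa [hone, leftAct_tmul, mul_one] at this
    rw [hA.twist_apply, hγ', hθc]
    -- Writing `a ⊗ 1_C` as its own image under `e` lets multiplicativity of `e` apply.
    nth_rw 1 [← h₁]
    rw [← hmul, LinearEquiv.symm_apply_apply, mul_tmul, leftAct_one, hA'.cross_inclA]
  · refine TensorProduct.ext' fun c d => ?_
    rw [LinearMap.comp_apply, LinearMap.comp_apply, TensorProduct.map_tmul, hγ', hθc, hθc, ← hmul,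
      LinearEquiv.symm_apply_apply, hA'.mul_inclV, actRight_tmul, leftAct_one]
  · rw [hθc, hone]
  · rw [hγc, LinearEquiv.symm_apply_eq, hone]
  · intro c
    rw [hγ', hθc, LinearEquiv.symm_apply_apply]
  · intro c
    rw [hθ', hγc, LinearEquiv.apply_symm_apply]
  · refine TensorProduct.ext' fun c d => ?_
    -- Since `e(γ d) = 1 ⊗ d`, what remains inside `leftExtend γ` is the product `(1 ⊗ c)(1 ⊗ d)`,
    -- which is `σ(c ⊗ d)`.
    rw [hA.twist_sigma_apply hA' (θ := θ), hθ', hγc,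
      LinearEquiv.apply_symm_apply, LinearMap.comp_apply, hA.mul_inclV, actRight_tmul, leftAct_one]
    intro x d
    rw [hγ', hγ', hθc, LinearEquiv.eq_symm_apply, hmul, LinearEquiv.apply_symm_apply]
  · intro a c
    rw [h'.isCrossedCoproduct.W_eq_conv, hD, conv_transportComul_W e hθ hγ]
  · intro a c
    rw [h'.isCrossedCoproduct.rho_eq_conv, hD, conv_transportComul_rho e hθ hγ hγcoact]
  · intro c
    rw [hθc, hcounit, counit_tmul, Bialgebra.counit_one, one_mul]
  · intro c
    rw [hγc, hcounit', counit_tmul, Bialgebra.counit_one, one_mul]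
  · intro c
    rw [hθc, hcoact, rightCoact_one_tmul, ← LinearMap.rTensor_comp_apply]

theorem equivalent_of_twist
    (h : IsCrossProductBialgebra (Coalgebra.counit (R := k) (A := A)) oneC R σ
      (W₀ k A C) (ρ₀ k A C))
    (hAlg : AlgebraTwist oneC θ γ R' σ' R σ) (hCoalg : CoalgebraTwist θ γ W' ρ') :
    IsCrossProductBialgebra (Coalgebra.counit (R := k) (A := A)) oneC R' σ' W' ρ' ∧
      Equivalent (Coalgebra.counit (R := k) (A := A)) oneC R' σ' W' ρ'
        R σ (W₀ k A C) (ρ₀ k A C) := by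
  have hA := h.isCrossedProduct
  have hcomp₁ : leftExtend θ ∘ₗ leftExtend γ = LinearMap.id := by
    refine TensorProduct.ext' fun a c => ?_
    simp [leftExtend_leftAct, hAlg.gamma_theta]
  have hcomp₂ : leftExtend γ ∘ₗ leftExtend θ = LinearMap.id := by
    refine TensorProduct.ext' fun a c => ?_
    simp [leftExtend_leftAct, hAlg.theta_gamma]
  let e : A ⊗[k] C ≃ₗ[k] A ⊗[k] C := LinearEquiv.ofLinearMap _ _ hcomp₁ hcomp₂
  have hθ : e.toLinearMap = leftExtend θ := rfl
  have hγ : e.symm.toLinearMap = leftExtend γ := rfl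
  have hθ' : ∀ x, e x = leftExtend θ x := fun _ => rfl
  have hγ' : ∀ x, e.symm x = leftExtend γ x := fun _ => rfl
  have hact : ∀ (a : A) (x : A ⊗[k] C),
      e (leftAct k A C (a ⊗ₜ[k] x)) = leftAct k A C (a ⊗ₜ[k] e x) := leftExtend_leftAct θ
  have hact' : ∀ (a : A) (x : A ⊗[k] C),
      e.symm (leftAct k A C (a ⊗ₜ[k] x)) = leftAct k A C (a ⊗ₜ[k] e.symm x) :=
    leftExtend_leftAct γ
  have hinclA : ∀ a : A, e (a ⊗ₜ[k] oneC) = a ⊗ₜ[k] oneC := fun a => by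
    rw [hθ', leftExtend_tmul, hAlg.theta_one, leftAct_tmul, mul_one]
  have hinclC : ∀ c : C, e ((1 : A) ⊗ₜ[k] c) = θ c := fun c => by
    rw [hθ', leftExtend_tmul, leftAct_one]
  have hcounit : ∀ x, counit (Coalgebra.counit (R := k) (A := A)) (e x) =
      counit (Coalgebra.counit (R := k) (A := A)) x := counit_leftExtend hCoalg.counit_theta
  have hcounit' : ∀ x, counit (Coalgebra.counit (R := k) (A := A)) (e.symm x) =
      counit (Coalgebra.counit (R := k) (A := A)) x := counit_leftExtend hCoalg.counit_gamma
  have hcoact : ∀ x, rightCoact k A C (e x) = e.toLinearMap.rTensor C (rightCoact k A C x) :=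
    rightCoact_leftExtend hCoalg.comul_theta
  have hcoact' : ∀ x, rightCoact k A C (e.symm x) =
      e.symm.toLinearMap.rTensor C (rightCoact k A C x) :=
    rightCoact_leftExtend hCoalg.comul_gamma
  -- The transported multiplication satisfies the hypotheses of `isCrossedProduct_of_assoc`.
  -- `A`-linearity of `e⁻¹`, together with `e` fixing `a ⊗ 1_C`, keeps the left action standard.
  have hassoc : ∀ x y z, transportMul e (mul R σ) (transportMul e (mul R σ) (x ⊗ₜ[k] y) ⊗ₜ[k] z) =
      transportMul e (mul R σ) (x ⊗ₜ[k] transportMul e (mul R σ) (y ⊗ₜ[k] z)) := by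
    intro x y z
    simp [hA.mul_assoc]
  have hunit : ∀ x, transportMul e (mul R σ) (x ⊗ₜ[k] ((1 : A) ⊗ₜ[k] oneC)) = x := by
    intro x
    rw [transportMul_tmul, hinclA, hA.mul_one, LinearEquiv.symm_apply_apply]
  have hsmul : ∀ (a : A) x, transportMul e (mul R σ) ((a ⊗ₜ[k] oneC) ⊗ₜ[k] x) =
      leftAct k A C (a ⊗ₜ[k] x) := by
    intro a x
    rw [transportMul_tmul, hinclA, hA.tmul_one_mul, hact', LinearEquiv.symm_apply_apply]
  have hR : ∀ c a, R' (c ⊗ₜ[k] a) =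
      transportMul e (mul R σ) (((1 : A) ⊗ₜ[k] c) ⊗ₜ[k] (a ⊗ₜ[k] oneC)) := by
    intro c a
    rw [transportMul_tmul, hinclA, hinclC, hAlg.R_eq, hA.twist_apply, hγ']
  have hσ : ∀ c d, σ' (c ⊗ₜ[k] d) =
      transportMul e (mul R σ) (((1 : A) ⊗ₜ[k] c) ⊗ₜ[k] ((1 : A) ⊗ₜ[k] d)) := by
    intro c d
    rw [transportMul_tmul, hinclC, hinclC, hAlg.sigma_eq, hγ']
    simp
  have hmul : mul R' σ' = transportMul e (mul R σ) := mul_eq_of_assoc hassoc hsmul hR hσ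
  let D := transportComul e (Coalgebra.comul (R := k) (A := A ⊗[k] C))
  have hW : W' = conv D (projRight (Coalgebra.counit (R := k) (A := A))) (projLeft k A C) := by
    refine TensorProduct.ext' fun a c => ?_
    rw [conv_transportComul_W e hθ hγ, hCoalg.W_eq]
  have hρ : ρ' = conv D (projLeft k A C) (projLeft k A C) := by
    refine TensorProduct.ext' fun a c => ?_
    rw [conv_transportComul_rho e hθ hγ hCoalg.comul_gamma, hCoalg.rho_eq]
  have hcoassoc := transportComul_coassoc e (Coalgebra.coassoc (R := k) (A := A ⊗[k] C))
  have hε : counit (Coalgebra.counit (R := k) (A := A)) ∘ₗ e.symm.toLinearMap =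
      Coalgebra.counit (R := k) (A := A ⊗[k] C) := by
    rw [← counit_counit]
    exact LinearMap.ext hcounit'
  have hleft : ∀ b, TensorProduct.lid k _
      ((counit (Coalgebra.counit (R := k) (A := A))).rTensor _ (D b)) = b := by
    intro b
    rw [transportComul_apply, ← LinearMap.comp_apply, LinearMap.rTensor_comp_map, hε,
      lid_map_apply, Coalgebra.rTensor_counit_comul]
    simp
  have hright : ∀ b, TensorProduct.rid k _
      ((counit (Coalgebra.counit (R := k) (A := A))).lTensor _ (D b)) = b := by
    intro b
    rw [transportComul_apply, ← LinearMap.comp_apply, LinearMap.lTensor_comp_map, hε,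
      rid_map_apply, Coalgebra.lTensor_counit_comul]
    simp
  -- `e⁻¹` preserves counit and coaction, and these determine `projRight`.
  have hproj : projRight (Coalgebra.counit (R := k) (A := A)) ∘ₗ e.symm.toLinearMap =
      projRight (C := C) (Coalgebra.counit (R := k) (A := A)) := by
    refine LinearMap.ext fun x => ?_
    rw [LinearMap.comp_apply, LinearEquiv.coe_coe, ← rTensor_counit_rightCoact, hcoact',
      ← LinearMap.rTensor_comp_apply, hε, ← counit_counit, rTensor_counit_rightCoact]
  -- By `hproj` the left side at `x` is `e⁻¹ ⊗ id` applied to the coaction of `e x`. Colinearity of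
  -- `e⁻¹` turns this into the coaction of `x`.
  have hDcoact : conv D LinearMap.id (projRight (Coalgebra.counit (R := k) (A := A))) =
      rightCoact k A C := by
    refine LinearMap.ext fun x => ?_
    rw [conv, LinearMap.comp_apply, transportComul_apply, ← LinearMap.comp_apply,
      ← TensorProduct.map_comp, hproj, LinearMap.id_comp]
    have h₁ := LinearMap.congr_fun (rTensor_comp_conv
      (D := Coalgebra.comul (R := k) (A := A ⊗[k] C)) LinearMap.id
      (projRight (Coalgebra.counit (R := k) (A := A))) e.symm.toLinearMap) (e x)
    rw [conv_comul_projRight, LinearMap.comp_id, LinearMap.comp_apply, ← hcoact',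
      LinearEquiv.symm_apply_apply] at h₁
    exact h₁.symm
  have hcomul : comul W' ρ' = transportComul e (comul (W₀ k A C) (ρ₀ k A C)) := by
    rw [comul_W₀_ρ₀]
    exact comul_eq_of_coassoc hcoassoc hDcoact hW hρ
  refine ⟨⟨isCrossedProduct_of_assoc hassoc hunit hsmul hR hσ,
    isCrossedCoproduct_of_coassoc hcoassoc hleft hright hDcoact hW hρ, h.counit_one, ?_, ?_, ?_⟩,
    e, hinclA 1, ?_, hcounit, ?_, hact, hcoact⟩
  · intro x y
    rw [hmul, transportMul_tmul, hcounit', h.counit_mul, hcounit, hcounit]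
  · rw [hcomul, transportComul_apply, hinclA, h.comul_one, TensorProduct.map_tmul,
      LinearEquiv.coe_coe, (LinearEquiv.symm_apply_eq e).mpr (hinclA 1).symm]
  · rw [hcomul, hmul]
    exact transportComul_transportMul e h.comul_mul
  · intro x y
    rw [hmul, transportMul_tmul, LinearEquiv.apply_symm_apply]
  · intro x
    rw [hcomul, transportComul_apply, ← LinearMap.comp_apply, ← TensorProduct.map_comp,
      LinearEquiv.comp_symm, TensorProduct.map_id, LinearMap.id_apply]

end Twist

end

end CrossProd

theorem mainTheorem3 {k A C : Type*} [Field k] [Ring A] [Bialgebra k A]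
    [AddCommGroup C] [Module k C] [Coalgebra k C] (oneC : C)
    (R : C ⊗[k] A →ₗ[k] A ⊗[k] C) (σ : C ⊗[k] C →ₗ[k] A ⊗[k] C)
    (h : CrossProd.IsCrossProductBialgebra (Coalgebra.counit (R := k) (A := A)) oneC R σ
      (CrossProd.W₀ k A C) (CrossProd.ρ₀ k A C))
    (R' : C ⊗[k] A →ₗ[k] A ⊗[k] C) (σ' : C ⊗[k] C →ₗ[k] A ⊗[k] C)
    (W' : A ⊗[k] C →ₗ[k] C ⊗[k] A) (ρ' : A ⊗[k] C →ₗ[k] A ⊗[k] A) :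
    (CrossProd.IsCrossProductBialgebra (Coalgebra.counit (R := k) (A := A)) oneC R' σ' W' ρ' ∧
      CrossProd.Equivalent (Coalgebra.counit (R := k) (A := A)) oneC R' σ' W' ρ'
        R σ (CrossProd.W₀ k A C) (CrossProd.ρ₀ k A C)) ↔
    ∃ θ γ : C →ₗ[k] A ⊗[k] C,
      CrossProd.AlgebraTwist oneC θ γ R' σ' R σ ∧ CrossProd.CoalgebraTwist θ γ W' ρ' := by
  constructor
  · rintro ⟨h', he⟩
    exact CrossProd.exists_twist_of_equivalent h h' he
  · rintro ⟨θ, γ, hAlg, hCoalg⟩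
    exact CrossProd.equivalent_of_twist h hAlg hCoalg
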